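/- **Setting.** Let $\Lambda_n$ ($n\in\mathbb N$) be finite connected graphs (lattices) whose site sets are finite subsets of an infinite set $V$ and exhaust $V$ (each site lies in $\Lambda_n$ for all large $n$). Assume that for any two sites the graph distance in $\Lambda_n$ eventually equals their distance $\mathrm{dist}(x,y)$ in an infinite graph on $V$. Each site carries finitely many fermion modes and a finite-dimensional (spin) space; the Hilbert space of $\Lambda_n$ is the fermionic Fock space over the modes of $\Lambda_n$ tensored with the spin spaces. Observables with support in a finite set $X$ are the elements of the $*$-algebra generated by the fermion and spin operators at sites of $X$. The Hamiltonian is $H_{\Lambda}=\sum_{X\subset\Lambda}h_X$, where $h_X$ (which may depend on $\Lambda=\Lambda_n$) is self-adjoint, supported in $X$, and even in the fermion operators. The interaction is called *power-law decaying with exponent $\eta>0$* if, with constants independent of $n$, and with distances and diameters taken in $\Lambda$, for all $x,y\in\Lambda$ either $$\sum_{X\ni x,y}\|h_X\|\le\frac{\lambda_0}{[1+\mathrm{dist}(x,y)]^{\eta}}\quad\text{and}\quad \sum_{z\in\Lambda}\frac1{[1+\mathrm{dist}(x,z)]^{\eta}}\frac1{[1+\mathrm{dist}(z,y)]^{\eta}}\le\frac{p_0}{[1+\mathrm{dist}(x,y)]^{\eta}},$$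 or $\sup_x\sum_{X\ni x}\|h_X\||X|[1+\mathrm{diam}(X)]^\eta\le s_1<\infty$. It is called *exponentially decaying with rate $\mu>0$* if, again uniformly in $n$, either $\sum_{X\ni x,y}\|h_X\|\le\lambda_0e^{-(\mu+\varepsilon)\mathrm{dist}(x,y)}$ for some $\lambda_0,\varepsilon>0$ and $\sup_x\sum_y[1+\mathrm{dist}(x,y)]^{-\eta'}<\infty$ for some $\eta'>0$, or $\sup_x\sum_{X\ni x}\|h_X\||X|e^{\mu\,\mathrm{diam}(X)}\le s_1<\infty$. There is a *uniform gap* $\Delta E>0$ above the ground state sector if for every $n$ there is a non-empty set $\mathcal E_{0}$ of eigenvalues at the bottom of the spectrum of $H_{\Lambda_n}$ whose spread $\max_{E,E'\in\mathcal E_0}|E-E'|$ tends to $0$ as $n\to\infty$, and all other eigenvalues lie above all of $\mathcal E_0$ by at least $\Delta E$. The ground state sector is the span of the eigenvectors with eigenvalue in $\mathcal E_0$, and $P_{0,\Lambda}$ is the orthogonal projection onto it. An infinite-volume ground-state expectation is a weak-$*$ limit, along a subsequence, $\omega(A)=\lim\langle\Phi_\Lambda,A\Phi_\Lambda\rangle$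 with $\Phi_\Lambda$ normalized vectors in the ground state sector, for which also the limits $\omega(AP_0B)=\lim\langle\Phi_\Lambda,AP_{0,\Lambda}B\Phi_\Lambda\rangle$ exist, for all observables $A,B$ of finite support. A pair of observables $A_X,B_Y$ with finite supports $X,Y$ is *fermionic* if $\{A_X,B_Y\}=0$ whenever $X\cap Y=\emptyset$, and *bosonic* if $[A_X,B_Y]=0$ whenever $X\cap Y=\emptyset$. Given a function $g$, a number $v>0$ is an *upper bound of the group velocity with spatial decay $g$* if there is a constant $C$ such that, for all $n$, all $t\in\mathbb R$, all bosonic pairs with $X,Y\subset\Lambda=\Lambda_n$ and $\mathrm{dist}(X,Y)>0$ (distance in $\Lambda$), $$\|[A_X(t),B_Y]\|\le C\|A_X\|\|B_Y\||X||Y|\,g(\mathrm{dist}(X,Y))\,(e^{v|t|}-1),\qquad A(t)=e^{itH_\Lambda}Ae^{-itH_\Lambda},$$ and the same holds with the anticommutator for fermionic pairs. **Theorem (Clustering of fermionic correlations).** For every such system there are strictly increasing functions $\eta\mapsto v_\eta>0$, on the set of exponents $\eta$ with which the interaction is power-law decaying, and $\mu\mapsto v_\mu>0$, on the set of rates $\mu$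 with which it is exponentially decaying, such that $v_\eta$ and $v_\mu$ are upper bounds of the group velocity with spatial decay $(1+r)^{-\eta}$ and $e^{-\mu r}$ respectively, and the following holds. Let $\Delta E>0$ and put $$\tilde\eta=\frac{\eta}{1+2v_\eta/\Delta E},\qquad \tilde\mu=\frac{\mu}{1+2v_\mu/\Delta E}.$$ For each admissible $\eta$ (respectively $\mu$) there is a constant $C$ such that, for every ground state sector with uniform gap $\Delta E$, every infinite-volume ground-state expectation $\omega$ obtained from it, and every fermionic pair $A_X,B_Y$ with finite supports $X,Y$, $$\Bigl|\omega(A_XB_Y)-\tfrac12\bigl[\omega(A_XP_0B_Y)-\omega(B_YP_0A_X)\bigr]\Bigr|\le C\|A_X\|\|B_Y\||X||Y|\times\begin{cases}[1+\mathrm{dist}(X,Y)]^{-\tilde\eta},&h_X\text{ power-law decaying with exponent }\eta,\\ e^{-\tilde\mu\,\mathrm{dist}(X,Y)},&h_X\text{ exponentially decaying with rate }\mu.\end{cases}$$ -/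

import Mathlib

open Filter Topology
open scoped InnerProductSpace

noncomputable section

namespace LatticeFermion

/-- Occupation-number configurations of a lattice system. `Finset M` lists the occupied fermion
modes; the second component gives at every site `x` the basis state of an additional
`(d x + 1)`-dimensional (spin) degree of freedom, equal to the reference state `0` at all but
finitely many sites. -/
abbrev Config {V : Type*} (M : Type*) (d : V → ℕ) : Type _ :=
  Finset M × (Π₀ x : V, Fin (d x + 1))

/-- The Hilbert space with orthonormal basis `Config M d`: the fermion Fock space over the modes
`M`, tensored with the spin spaces. -/
abbrev Hilb {V : Type*} (M : Type*) (d : V → ℕ) : Type _ :=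
  lp (fun _ : Config M d => ℂ) 2

/-- Bounded operators. -/
abbrev Op {V : Type*} (M : Type*) (d : V → ℕ) : Type _ :=
  Hilb M d →L[ℂ] Hilb M d

section BasicOperator

variable {C : Type*}

theorem summable_weighted (f : C → C) (a : C → ℂ) (ha : ∀ s, ‖a s‖ ≤ 1)
    (hf : Set.InjOn f {s | a s ≠ 0}) (ξ : lp (fun _ : C => ℂ) 2) :
    Summable (fun s => ‖a s * ξ (f s)‖ ^ 2) ∧
      ∑' s, ‖a s * ξ (f s)‖ ^ 2 ≤ ‖ξ‖ ^ 2 := by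
  have hsum : HasSum (fun s => ‖ξ s‖ ^ 2) (‖ξ‖ ^ 2) := by
    have := lp.hasSum_norm (p := 2) (by norm_num) ξ
    simpa using this
  have key : ∀ u : Finset C, ∑ s ∈ u, ‖a s * ξ (f s)‖ ^ 2 ≤ ‖ξ‖ ^ 2 := by
    intro u
    classical
    have h1 : ∑ s ∈ u, ‖a s * ξ (f s)‖ ^ 2
        = ∑ s ∈ u.filter (fun s => a s ≠ 0), ‖a s * ξ (f s)‖ ^ 2 := by
      refine (Finset.sum_filter_of_ne ?_).symm
      intro s _ hs h0
      exact hs (by simp [h0])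
    have h2 : ∑ s ∈ u.filter (fun s => a s ≠ 0), ‖a s * ξ (f s)‖ ^ 2
        ≤ ∑ s ∈ u.filter (fun s => a s ≠ 0), ‖ξ (f s)‖ ^ 2 := by
      refine Finset.sum_le_sum fun s _ => ?_
      rw [norm_mul]
      have := ha s
      have h3 : ‖a s‖ * ‖ξ (f s)‖ ≤ ‖ξ (f s)‖ :=
        mul_le_of_le_one_left (norm_nonneg _) this
      exact pow_le_pow_left₀ (by positivity) h3 2
    have h4 : ∑ s ∈ u.filter (fun s => a s ≠ 0), ‖ξ (f s)‖ ^ 2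
        = ∑ s ∈ (u.filter (fun s => a s ≠ 0)).image f, ‖ξ s‖ ^ 2 := by
      rw [Finset.sum_image]
      intro x hx y hy hxy
      exact hf (by simpa using (Finset.mem_filter.mp hx).2)
        (by simpa using (Finset.mem_filter.mp hy).2) hxy
    rw [h1]
    refine h2.trans (h4.le.trans ?_)
    exact sum_le_hasSum _ (fun _ _ => by positivity) hsum
  have hs : Summable (fun s => ‖a s * ξ (f s)‖ ^ 2) :=
    summable_of_sum_le (fun _ => by positivity) key
  exact ⟨hs, hs.tsum_le_of_sum_le key⟩

/-- The bounded operator `(T ξ) s = a s * ξ (f s)` on `ℓ²(C)`, for coefficients bounded by `1`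
and a map `f` that is injective where `a ≠ 0`. -/
def weightedComp (f : C → C) (a : C → ℂ) (ha : ∀ s, ‖a s‖ ≤ 1)
    (hf : Set.InjOn f {s | a s ≠ 0}) :
    lp (fun _ : C => ℂ) 2 →L[ℂ] lp (fun _ : C => ℂ) 2 :=
  LinearMap.mkContinuous
    { toFun := fun ξ => ⟨fun s => a s * ξ (f s), by
        refine (memℓp_gen_iff (by norm_num)).2 ?_
        simpa using (summable_weighted f a ha hf ξ).1⟩
      map_add' := fun ξ ζ => by
        ext s
        exact mul_add _ _ _
      map_smul' := fun z ξ => by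
        ext s
        simp [mul_left_comm] }
    1 (fun ξ => by
      rw [one_mul]
      refine lp.norm_le_of_tsum_le (by norm_num) (norm_nonneg _) ?_
      simpa using (summable_weighted f a ha hf ξ).2)

theorem weightedComp_apply (f : C → C) (a : C → ℂ) (ha : ∀ s, ‖a s‖ ≤ 1)
    (hf : Set.InjOn f {s | a s ≠ 0}) (ξ : lp (fun _ : C => ℂ) 2) (s : C) :
    weightedComp f a ha hf ξ s = a s * ξ (f s) := rfl

end BasicOperator

section Generators

variable {V M : Type*} [DecidableEq V] [LinearOrder M]

/-- The fermion annihilation operator of the mode `m`: it removes `m` from the occupied modes with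
the sign `(-1) ^ #{occupied modes below m}`. Its adjoint is the creation operator. -/
def annihilation (d : V → ℕ) (m : M) : Op M d :=
  weightedComp (fun s => (insert m s.1, s.2))
    (fun s => if m ∈ s.1 then 0 else (-1 : ℂ) ^ (s.1.filter (· < m)).card)
    (fun s => by split_ifs <;> simp)
    (by
      rintro ⟨s, σ⟩ hs ⟨t, τ⟩ ht h
      have hs' : m ∉ s := fun hm => hs (by simp [hm])
      have ht' : m ∉ t := fun hm => ht (by simp [hm])
      simp only [Prod.mk.injEq] at h
      refine Prod.ext ?_ h.2
      have := congrArg (fun u => Finset.erase u m) h.1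
      simpa [Finset.erase_insert hs', Finset.erase_insert ht'] using this)

/-- The matrix unit `|a⟩⟨b|` of the spin degree of freedom at the site `x`. -/
def spinUnit (M : Type*) (d : V → ℕ) (x : V) (a b : Fin (d x + 1)) : Op M d :=
  weightedComp (fun s => (s.1, s.2.update x b)) (fun s => if s.2 x = a then 1 else 0)
    (fun s => by split_ifs <;> simp)
    (by
      rintro ⟨s, σ⟩ hs ⟨t, τ⟩ ht h
      have hs' : σ x = a := by
        by_contra hc
        exact hs (by simp [hc])
      have ht' : τ x = a := by
        by_contra hc
        exact ht (by simp [hc])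
      simp only [Prod.mk.injEq] at h
      refine Prod.ext h.1 ?_
      refine DFinsupp.ext fun y => ?_
      by_cases hy : y = x
      · subst hy
        exact hs'.trans ht'.symm
      · have := DFunLike.congr_fun h.2 y
        simpa [DFinsupp.coe_update, Function.update_of_ne hy] using this)

/-- The fermion parity operator `(-1) ^ (number of fermions)`. -/
def parity (M : Type*) (d : V → ℕ) : Op M d :=
  weightedComp id (fun s => (-1 : ℂ) ^ s.1.card) (fun s => by simp) (Set.injOn_id _)

/-- The algebra of observables with support in `X`: the `*`-algebra generated by the fermion
operators of the modes at sites of `X` and by the spin operators at sites of `X`. -/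
def localAlgebra (site : M → V) (d : V → ℕ) (X : Finset V) : StarSubalgebra ℂ (Op M d) :=
  StarAlgebra.adjoin ℂ
    ({T | ∃ m, site m ∈ X ∧ T = annihilation d m} ∪
      {T | ∃ x ∈ X, ∃ a b, T = spinUnit M d x a b})

/-- The state space of the finite region `X`: all modes off `X` are empty and all spins off `X` are
in the reference state. -/
def regionSpace (site : M → V) (d : V → ℕ) (X : Finset V) : Submodule ℂ (Hilb M d) where
  carrier := {ξ | ∀ s : Config M d,
    ¬ ((∀ m ∈ s.1, site m ∈ X) ∧ ∀ x, s.2 x ≠ 0 → x ∈ X) → ξ s = 0}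
  add_mem' := by
    intro ξ ζ hξ hζ s hs
    simp [hξ s hs, hζ s hs]
  zero_mem' := by
    intro s _
    simp
  smul_mem' := by
    intro z ξ hξ s hs
    simp [hξ s hs]

theorem finite_regionConfig (site : M → V) (hsite : ∀ x, (site ⁻¹' {x}).Finite) (d : V → ℕ)
    (X : Finset V) :
    Finite {s : Config M d // (∀ m ∈ s.1, site m ∈ X) ∧ ∀ x, s.2 x ≠ 0 → x ∈ X} := by
  have hF : (site ⁻¹' (X : Set V)).Finite := by
    have : site ⁻¹' (X : Set V) = ⋃ x ∈ X, site ⁻¹' {x} := by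
      ext m
      simp
    rw [this]
    exact X.finite_toSet.biUnion fun x _ => hsite x
  let F : {s : Config M d // (∀ m ∈ s.1, site m ∈ X) ∧ ∀ x, s.2 x ≠ 0 → x ∈ X} →
      {u : Finset M // u ∈ hF.toFinset.powerset} × (∀ x : {x // x ∈ X}, Fin (d x.1 + 1)) :=
    fun s => (⟨s.1.1, Finset.mem_powerset.2 fun m hm => by
      simpa using s.2.1 m hm⟩, fun x => s.1.2 x.1)
  refine Finite.of_injective F ?_
  rintro ⟨⟨s, σ⟩, hs⟩ ⟨⟨t, τ⟩, ht⟩ h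
  have h1 : s = t := congrArg (fun p => p.1.1) h
  have h2 : ∀ x : {x // x ∈ X}, σ x.1 = τ x.1 := fun x => congrFun (congrArg Prod.snd h) x
  refine Subtype.ext (Prod.ext h1 (DFinsupp.ext fun x => ?_))
  by_cases hx : x ∈ X
  · exact h2 ⟨x, hx⟩
  · have e1 : σ x = 0 := by
      by_contra hc
      exact hx (hs.2 x hc)
    have e2 : τ x = 0 := by
      by_contra hc
      exact hx (ht.2 x hc)
    exact e1.trans e2.symm

theorem finiteDimensional_regionSpace (site : M → V) (hsite : ∀ x, (site ⁻¹' {x}).Finite)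
    (d : V → ℕ) (X : Finset V) : FiniteDimensional ℂ (regionSpace site d X) := by
  have := finite_regionConfig site hsite d X
  let F : regionSpace site d X →ₗ[ℂ]
      ({s : Config M d // (∀ m ∈ s.1, site m ∈ X) ∧ ∀ x, s.2 x ≠ 0 → x ∈ X} → ℂ) :=
    { toFun := fun ξ s => ξ.1 s.1
      map_add' := fun ξ ζ => rfl
      map_smul' := fun z ξ => rfl }
  refine FiniteDimensional.of_injective F ?_
  intro ξ ζ h
  refine Subtype.ext (lp.ext (funext fun s => ?_))
  by_cases hs : (∀ m ∈ s.1, site m ∈ X) ∧ ∀ x, s.2 x ≠ 0 → x ∈ X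
  · exact congrFun h ⟨s, hs⟩
  · exact (ξ.2 s hs).trans (ζ.2 s hs).symm

end Generators

/-- Distance of two finite sets of sites. -/
def setDist {V : Type*} (G : SimpleGraph V) (X Y : Finset V) : ℕ :=
  sInf {r | ∃ x ∈ X, ∃ y ∈ Y, r = G.dist x y}

/-- Diameter of a finite set of sites. -/
def setDiam {V : Type*} (G : SimpleGraph V) (X : Finset V) : ℕ :=
  (X ×ˢ X).sup fun p => G.dist p.1 p.2

/-- A sequence of finite lattice systems going to the infinite volume.

`V` is the set of all sites and `M` the set of all fermion modes; the order of `M` only fixes signs.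
The `n`-th finite lattice has the sites `Λ n`, the bonds `bonds n`, and the interaction
`h n X`, `X ⊆ Λ n`. Bonds and interaction may depend on `n` in any way (for example through
boundary conditions), as long as the graph distance of any two fixed sites is eventually their
distance in the infinite lattice. -/
structure LatticeSystem (V M : Type*) [DecidableEq V] [LinearOrder M] where
  /-- the site at which a mode lives -/
  site : M → V
  finite_modes : ∀ x, (site ⁻¹' {x}).Finite
  /-- the spin space at `x` has dimension `d x + 1` -/
  d : V → ℕ
  Λ : ℕ → Finset V
  exhausts : ∀ x, ∀ᶠ n in atTop, x ∈ Λ n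
  bonds : ℕ → SimpleGraph V
  bonds_subset : ∀ n x y, (bonds n).Adj x y → x ∈ Λ n ∧ y ∈ Λ n
  connected : ∀ n, ∀ x ∈ Λ n, ∀ y ∈ Λ n, (bonds n).Reachable x y
  /-- the infinite lattice -/
  graph : SimpleGraph V
  dist_eventually : ∀ x y, ∀ᶠ n in atTop, (bonds n).dist x y = graph.dist x y
  /-- the local Hamiltonians -/
  h : ℕ → Finset V → Op M d
  h_mem : ∀ n X, h n X ∈ localAlgebra site d X
  h_selfAdjoint : ∀ n X, IsSelfAdjoint (h n X)
  /-- local Hamiltonians are even in the fermion operators -/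
  h_even : ∀ n X, Commute (parity M d) (h n X)

namespace LatticeSystem

variable {V M : Type*} [DecidableEq V] [LinearOrder M] (L : LatticeSystem V M)

/-- Observables with support in `X`. -/
abbrev obs (X : Finset V) : StarSubalgebra ℂ (Op M L.d) := localAlgebra L.site L.d X

/-- The state space of the `n`-th finite lattice. -/
abbrev space (n : ℕ) : Submodule ℂ (Hilb M L.d) := regionSpace L.site L.d (L.Λ n)

/-- The Hamiltonian `H_Λ = ∑_{X ⊆ Λ} h_X`. -/
def hamiltonian (n : ℕ) : Op M L.d := ∑ X ∈ (L.Λ n).powerset, L.h n X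

/-- The Heisenberg time evolution `A(t) = exp(itH) A exp(-itH)`. -/
def evolve (n : ℕ) (t : ℝ) (A : Op M L.d) : Op M L.d :=
  NormedSpace.exp ((Complex.I * (t : ℂ)) • L.hamiltonian n) * A *
    NormedSpace.exp ((-(Complex.I * (t : ℂ))) • L.hamiltonian n)

/-! ### Decay of the interaction -/

/-- `∑_{X ∋ x, y} ‖h_X‖` -/
def pairStrength (n : ℕ) (x y : V) : ℝ :=
  ∑ X ∈ (L.Λ n).powerset with x ∈ X ∧ y ∈ X, ‖L.h n X‖

/-- Pairwise power-law decay with exponent `η`, on lattices with the convolution property. -/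
def PowerLawPair (η : ℝ) : Prop :=
  ∃ lam₀ p₀ : ℝ, 0 < lam₀ ∧ 0 < p₀ ∧ ∀ n, ∀ x ∈ L.Λ n, ∀ y ∈ L.Λ n,
    L.pairStrength n x y ≤ lam₀ / (1 + ((L.bonds n).dist x y : ℝ)) ^ η ∧
    ∑ z ∈ L.Λ n, 1 / (1 + ((L.bonds n).dist x z : ℝ)) ^ η *
        (1 / (1 + ((L.bonds n).dist z y : ℝ)) ^ η)
      ≤ p₀ / (1 + ((L.bonds n).dist x y : ℝ)) ^ η

/-- Power-law decay with exponent `η` in terms of the diameter of the supports. -/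
def PowerLawSum (η : ℝ) : Prop :=
  ∃ s₁ : ℝ, ∀ n, ∀ x ∈ L.Λ n,
    ∑ X ∈ (L.Λ n).powerset with x ∈ X,
      ‖L.h n X‖ * (X.card : ℝ) * (1 + (setDiam (L.bonds n) X : ℝ)) ^ η ≤ s₁

/-- Power-law decaying interactions with exponent `η`. -/
def PowerLaw (η : ℝ) : Prop := 0 < η ∧ (L.PowerLawPair η ∨ L.PowerLawSum η)

/-- Pairwise exponential decay (with a rate larger than `μ`), on lattices with
`sup_Λ sup_x ∑_y (1 + dist(x,y))^{-η} < ∞` for some `η > 0`. -/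
def ExponentialPair (μ : ℝ) : Prop :=
  (∃ η K : ℝ, 0 < η ∧ ∀ n, ∀ x ∈ L.Λ n,
    ∑ y ∈ L.Λ n, 1 / (1 + ((L.bonds n).dist x y : ℝ)) ^ η ≤ K) ∧
  ∃ lam₀ ε : ℝ, 0 < lam₀ ∧ 0 < ε ∧ ∀ n, ∀ x ∈ L.Λ n, ∀ y ∈ L.Λ n,
    L.pairStrength n x y ≤ lam₀ * Real.exp (-(μ + ε) * ((L.bonds n).dist x y : ℝ))

/-- Exponential decay with rate `μ` in terms of the diameter of the supports. -/
def ExponentialSum (μ : ℝ) : Prop :=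
  ∃ s₁ : ℝ, ∀ n, ∀ x ∈ L.Λ n,
    ∑ X ∈ (L.Λ n).powerset with x ∈ X,
      ‖L.h n X‖ * (X.card : ℝ) * Real.exp (μ * (setDiam (L.bonds n) X : ℝ)) ≤ s₁

/-- Exponentially decaying interactions with rate `μ`. -/
def Exponential (μ : ℝ) : Prop := 0 < μ ∧ (L.ExponentialPair μ ∨ L.ExponentialSum μ)

/-! ### Fermionic and bosonic pairs, group velocity -/

/-- `A` and `B`, with supports `X` and `Y`, anticommute if the supports are disjoint. -/
def FermionicPair (X Y : Finset V) (A B : Op M L.d) : Prop :=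
  A ∈ L.obs X ∧ B ∈ L.obs Y ∧ (Disjoint X Y → A * B + B * A = 0)

/-- `A` and `B`, with supports `X` and `Y`, commute if the supports are disjoint. -/
def BosonicPair (X Y : Finset V) (A B : Op M L.d) : Prop :=
  A ∈ L.obs X ∧ B ∈ L.obs Y ∧ (Disjoint X Y → A * B - B * A = 0)

/-- `v` is an upper bound of the group velocity of the information propagation, with the spatial
decay `g`, uniformly in the volume: for separated supports,
`‖[A(t), B]‖ ≤ C ‖A‖ ‖B‖ |X| |Y| g(dist(X,Y)) (e^{v|t|} - 1)` for bosonic pairs, and the same for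
the anticommutator of fermionic pairs. -/
def GroupVelocityBound (g : ℕ → ℝ) (v : ℝ) : Prop :=
  ∃ C : ℝ, 0 < C ∧ ∀ (n : ℕ) (X Y : Finset V) (A B : Op M L.d) (t : ℝ),
    X ⊆ L.Λ n → Y ⊆ L.Λ n → 0 < setDist (L.bonds n) X Y →
    (L.BosonicPair X Y A B →
      ‖L.evolve n t A * B - B * L.evolve n t A‖ ≤
        C * ‖A‖ * ‖B‖ * X.card * Y.card * g (setDist (L.bonds n) X Y) *
          (Real.exp (v * |t|) - 1)) ∧
    (L.FermionicPair X Y A B →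
      ‖L.evolve n t A * B + B * L.evolve n t A‖ ≤
        C * ‖A‖ * ‖B‖ * X.card * Y.card * g (setDist (L.bonds n) X Y) *
          (Real.exp (v * |t|) - 1))

/-! ### Uniform gap and infinite-volume ground states -/

/-- The spectrum of the Hamiltonian of the `n`-th finite lattice (its state space is
finite-dimensional). -/
def energies (n : ℕ) : Set ℝ :=
  {E | ∃ ξ ∈ L.space n, ξ ≠ 0 ∧ L.hamiltonian n ξ = (E : ℂ) • ξ}

/-- The energies `E₀ n` form a (quasi)degenerate ground state sector at the bottom of the spectrum:
their spread tends to `0`, and the rest of the spectrum lies above them by at least `ΔE`, for every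
volume. -/
structure UniformGap (E₀ : ℕ → Finset ℝ) (ΔE : ℝ) : Prop where
  nonempty : ∀ n, (E₀ n).Nonempty
  subset : ∀ n, (E₀ n : Set ℝ) ⊆ L.energies n
  spread : Tendsto (fun n => Metric.diam (E₀ n : Set ℝ)) atTop (𝓝 0)
  gap_pos : 0 < ΔE
  gap : ∀ n, ∀ e ∈ E₀ n, ∀ E ∈ L.energies n, E ∉ E₀ n → e + ΔE ≤ E

/-- The ground state sector of the `n`-th finite lattice. -/
def sector (E₀ : ℕ → Finset ℝ) (n : ℕ) : Submodule ℂ (Hilb M L.d) :=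
  Submodule.span ℂ {ξ | ξ ∈ L.space n ∧ ∃ e ∈ E₀ n, L.hamiltonian n ξ = (e : ℂ) • ξ}

instance finiteDimensional_sector (E₀ : ℕ → Finset ℝ) (n : ℕ) :
    FiniteDimensional ℂ (L.sector E₀ n) := by
  have := finiteDimensional_regionSpace L.site L.finite_modes L.d (L.Λ n)
  exact Submodule.finiteDimensional_of_le
    (Submodule.span_le.2 fun ξ hξ => hξ.1 : L.sector E₀ n ≤ L.space n)

/-- The orthogonal projection `P_{0,Λ}` onto the ground state sector. -/
def sectorProj (E₀ : ℕ → Finset ℝ) (n : ℕ) : Op M L.d := (L.sector E₀ n).starProjection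

/-- `ω` is an infinite-volume ground-state expectation: the weak-* limit, along a subsequence `φ` of
the finite lattices, of the expectations in normalized vectors `Φ n` of the ground state sectors.
`ωP A B` is the limit `ω(A P₀ B)`. Only their values on observables of finite support matter. -/
structure IsGroundStateLimit (E₀ : ℕ → Finset ℝ) (φ : ℕ → ℕ) (Φ : ℕ → Hilb M L.d)
    (ω : Op M L.d → ℂ) (ωP : Op M L.d → Op M L.d → ℂ) : Prop where
  strictMono : StrictMono φ
  mem_sector : ∀ n, Φ n ∈ L.sector E₀ n
  norm_eq_one : ∀ n, ‖Φ n‖ = 1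
  tendsto : ∀ X : Finset V, ∀ A ∈ L.obs X,
    Tendsto (fun j => ⟪Φ (φ j), A (Φ (φ j))⟫_ℂ) atTop (𝓝 (ω A))
  tendsto_proj : ∀ X Y : Finset V, ∀ A ∈ L.obs X, ∀ B ∈ L.obs Y,
    Tendsto (fun j => ⟪Φ (φ j), A (L.sectorProj E₀ (φ j) (B (Φ (φ j))))⟫_ℂ) atTop (𝓝 (ωP A B))

/-- Clustering of fermionic correlations with the decay `g` under a uniform gap `ΔE`. The constant
depends neither on the observables and their supports nor on the ground-state expectation. -/
def FermionicClustering (ΔE : ℝ) (g : ℕ → ℝ) : Prop :=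
  ∃ C : ℝ, ∀ E₀ : ℕ → Finset ℝ, L.UniformGap E₀ ΔE →
    ∀ (φ : ℕ → ℕ) (Φ : ℕ → Hilb M L.d) (ω : Op M L.d → ℂ) (ωP : Op M L.d → Op M L.d → ℂ),
      L.IsGroundStateLimit E₀ φ Φ ω ωP →
        ∀ (X Y : Finset V) (A B : Op M L.d), L.FermionicPair X Y A B →
          ‖ω (A * B) - 1 / 2 * (ωP A B - ωP B A)‖ ≤
            C * ‖A‖ * ‖B‖ * X.card * Y.card * g (setDist L.graph X Y)

end LatticeSystem
end LatticeFermion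

end

namespace LatticeFermion

section Propagator

variable {𝒜 : Type*} [NormedRing 𝒜] [StarRing 𝒜] [CStarRing 𝒜] [NormedAlgebra ℂ 𝒜]
  [StarModule ℂ 𝒜] [CompleteSpace 𝒜]

/-- The unitary group `exp(itH)`. -/
noncomputable def propagator (H : 𝒜) (t : ℝ) : 𝒜 := NormedSpace.exp ((Complex.I * (t : ℂ)) • H)

omit [CStarRing 𝒜] [StarRing 𝒜] [StarModule ℂ 𝒜] [CompleteSpace 𝒜] in
theorem propagator_zero (H : 𝒜) : propagator H 0 = 1 := by
  simp [propagator, NormedSpace.exp_zero]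

theorem propagator_mem_unitary {H : 𝒜} (hH : IsSelfAdjoint H) (t : ℝ) :
    propagator H t ∈ unitary 𝒜 := by
  have h : IsSelfAdjoint ((t : ℂ) • H) := IsSelfAdjoint.smul (by simp [IsSelfAdjoint]) hH
  have := (selfAdjoint.expUnitary ⟨(t : ℂ) • H, h⟩).2
  rwa [selfAdjoint.expUnitary_coe, smul_smul] at this

theorem star_propagator {H : 𝒜} (hH : IsSelfAdjoint H) (t : ℝ) :
    star (propagator H t) = propagator H (-t) := by
  rw [propagator, propagator, NormedSpace.star_exp, star_smul, hH.star_eq]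
  simp

theorem propagator_mul_neg {H : 𝒜} (hH : IsSelfAdjoint H) (t : ℝ) :
    propagator H t * propagator H (-t) = 1 := by
  rw [← star_propagator hH]
  exact (Unitary.mem_iff.1 (propagator_mem_unitary hH t)).2

theorem propagator_neg_mul {H : 𝒜} (hH : IsSelfAdjoint H) (t : ℝ) :
    propagator H (-t) * propagator H t = 1 := by
  rw [← star_propagator hH]
  exact (Unitary.mem_iff.1 (propagator_mem_unitary hH t)).1

theorem norm_propagator_mul {H : 𝒜} (hH : IsSelfAdjoint H) (t : ℝ) (T : 𝒜) :
    ‖propagator H t * T‖ = ‖T‖ :=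
  CStarRing.norm_mem_unitary_mul T (propagator_mem_unitary hH t)

theorem norm_mul_propagator {H : 𝒜} (hH : IsSelfAdjoint H) (t : ℝ) (T : 𝒜) :
    ‖T * propagator H t‖ = ‖T‖ :=
  CStarRing.norm_mul_mem_unitary T (propagator_mem_unitary hH t)

omit [CStarRing 𝒜] [StarRing 𝒜] [StarModule ℂ 𝒜] in
theorem hasDerivAt_propagator (H : 𝒜) (t : ℝ) :
    HasDerivAt (propagator H) (propagator H t * (Complex.I • H)) t := by
  have h := hasDerivAt_exp_smul_const (𝕂 := ℝ) (Complex.I • H) t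
  have e : ∀ u : ℝ, u • (Complex.I • H) = (Complex.I * (u : ℂ)) • H := fun u => by
    rw [← Complex.coe_smul, smul_smul, mul_comm]
  have h' : HasDerivAt (fun u : ℝ => NormedSpace.exp (u • (Complex.I • H)))
      (NormedSpace.exp (t • (Complex.I • H)) * (Complex.I • H)) t := h
  simp only [e] at h'
  exact h'

omit [CStarRing 𝒜] [StarRing 𝒜] [StarModule ℂ 𝒜] in
theorem hasDerivAt_propagator_neg (H : 𝒜) (t : ℝ) :
    HasDerivAt (fun s => propagator H (-s)) (-(propagator H (-t) * (Complex.I • H))) t := by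
  have h := (hasDerivAt_propagator H (-t)).scomp t (hasDerivAt_neg t)
  rw [neg_one_smul] at h
  exact h

omit [CStarRing 𝒜] [StarRing 𝒜] [StarModule ℂ 𝒜] [CompleteSpace 𝒜] in
theorem commute_propagator {H T : 𝒜} (h : Commute H T) (t : ℝ) : Commute (propagator H t) T :=
  (h.smul_left _).exp_left

/-- The Heisenberg evolution generated by `H`. -/
noncomputable def heisenberg (H : 𝒜) (t : ℝ) (A : 𝒜) : 𝒜 :=
  propagator H t * A * propagator H (-t)

theorem norm_heisenberg {H : 𝒜} (hH : IsSelfAdjoint H) (t : ℝ) (A : 𝒜) :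
    ‖heisenberg H t A‖ = ‖A‖ := by
  rw [heisenberg, norm_mul_propagator hH, norm_propagator_mul hH]

/-- A differential inequality for the twisted commutator `A(t) B + σ B A(t)`: only the part `K` of
the Hamiltonian `R + K` that does not commute with `A` contributes. -/
theorem norm_twisted_commutator_le {R K A B : 𝒜} {σ : ℂ} (hσ : ‖σ‖ ≤ 1) (hR : IsSelfAdjoint R)
    (hH : IsSelfAdjoint (R + K)) (hRA : Commute R A) {Ψ Ψ' : ℝ → ℝ}
    (h0 : ‖A * B + σ • (B * A)‖ ≤ Ψ 0) (hΨ : ∀ t, HasDerivAt Ψ (Ψ' t) t)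
    (hb : ∀ t, 0 ≤ t → 2 * ‖A‖ * ‖heisenberg (R + K) t K * B - B * heisenberg (R + K) t K‖ ≤ Ψ' t)
    {t : ℝ} (ht : 0 ≤ t) :
    ‖heisenberg (R + K) t A * B + σ • (B * heisenberg (R + K) t A)‖ ≤ Ψ t := by
  set H := R + K with hHdef
  set P := propagator H
  set Q := propagator R
  have hPP' : ∀ s, P (-s) * P s = 1 := propagator_neg_mul hH
  let W : ℝ → 𝒜 := fun s => Q s * (P (-s) * B * P s) * Q (-s)
  let W' : ℝ → 𝒜 := fun s => Q s * (P (-s) * (-(Complex.I • (heisenberg H s K * B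
    - B * heisenberg H s K))) * P s) * Q (-s)
  have hW : ∀ s, HasDerivAt W (W' s) s := by
    intro s
    have h1 := ((((hasDerivAt_propagator_neg H s).mul_const B).mul (hasDerivAt_propagator H s)))
    have h2 := ((hasDerivAt_propagator R s).mul h1).mul (hasDerivAt_propagator_neg R s)
    refine h2.congr_deriv ?_
    have c2 : Q (-s) * R = R * Q (-s) := (commute_propagator (Commute.refl R) (-s))
    have c4 : P (-s) * H = H * P (-s) := (commute_propagator (Commute.refl H) (-s))
    have e1 : P (-s) * (heisenberg H s K * B - B * heisenberg H s K) * P s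
        = K * (P (-s) * B * P s) - (P (-s) * B * P s) * K := by
      change P (-s) * (P s * K * P (-s) * B - B * (P s * K * P (-s))) * P s = _
      calc _ = (P (-s) * P s) * K * P (-s) * B * P s
              - P (-s) * B * P s * K * (P (-s) * P s) := by noncomm_ring
        _ = _ := by rw [hPP']; noncomm_ring
    have e2 : W' s = -(Complex.I • (Q s * (K * (P (-s) * B * P s)
        - (P (-s) * B * P s) * K) * Q (-s))) := by
      simp only [W', ← e1, mul_neg, neg_mul, mul_smul_comm, smul_mul_assoc]
    rw [e2]
    change (Q s * (Complex.I • R) * (P (-s) * B * P s) + Q s *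
      (-(P (-s) * (Complex.I • H)) * B * P s + P (-s) * B * (P s * (Complex.I • H)))) * Q (-s)
      + Q s * (P (-s) * B * P s) * -(Q (-s) * (Complex.I • R)) = _
    simp only [mul_smul_comm, smul_mul_assoc, ← smul_neg, ← smul_add, c2, c4]
    congr 1
    rw [hHdef]
    noncomm_ring
  have key : ∀ s, ‖A * W s + σ • (W s * A)‖
      = ‖heisenberg H s A * B + σ • (B * heisenberg H s A)‖ := by
    intro s
    have cA : Q s * A = A * Q s := commute_propagator hRA s
    have cA' : Q (-s) * A = A * Q (-s) := commute_propagator hRA (-s)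
    have : A * W s + σ • (W s * A) = Q s * (P (-s) * (heisenberg H s A * B
        + σ • (B * heisenberg H s A)) * P s) * Q (-s) := by
      change A * (Q s * (P (-s) * B * P s) * Q (-s)) + σ • ((Q s * (P (-s) * B * P s) * Q (-s)) * A)
        = Q s * (P (-s) * (P s * A * P (-s) * B + σ • (B * (P s * A * P (-s)))) * P s) * Q (-s)
      have e1 : A * (Q s * (P (-s) * B * P s) * Q (-s))
          = Q s * (P (-s) * (P s * A * P (-s) * B) * P s) * Q (-s) := by
        calc _ = (A * Q s) * (P (-s) * B * P s) * Q (-s) := by noncomm_ring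
          _ = Q s * ((P (-s) * P s) * A * P (-s) * B * P s) * Q (-s) := by
            rw [← cA, hPP']; noncomm_ring
          _ = _ := by noncomm_ring
      have e2 : (Q s * (P (-s) * B * P s) * Q (-s)) * A
          = Q s * (P (-s) * (B * (P s * A * P (-s))) * P s) * Q (-s) := by
        calc _ = Q s * (P (-s) * B * P s) * (Q (-s) * A) := by noncomm_ring
          _ = Q s * (P (-s) * B * P s * A * (P (-s) * P s)) * Q (-s) := by
            rw [cA', hPP']; noncomm_ring
          _ = _ := by noncomm_ring
      rw [e1, e2]
      simp only [mul_add, add_mul, mul_smul_comm, smul_mul_assoc]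
    rw [this, norm_mul_propagator hR, norm_propagator_mul hR, norm_mul_propagator hH,
      norm_propagator_mul hH]
  have hWn : ∀ s, ‖W' s‖ = ‖heisenberg H s K * B - B * heisenberg H s K‖ := by
    intro s
    rw [norm_mul_propagator hR, norm_propagator_mul hR, norm_mul_propagator hH,
      norm_propagator_mul hH, norm_neg, norm_smul, Complex.norm_I, one_mul]
  have hf : ∀ s, HasDerivAt (fun s => A * W s + σ • (W s * A)) (A * W' s + σ • (W' s * A)) s :=
    fun s => ((hW s).const_mul A).add (((hW s).mul_const A).const_smul σ)
  rw [← key]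
  refine image_norm_le_of_norm_deriv_right_le_deriv_boundary (a := 0) (b := t)
    (f' := fun s => A * W' s + σ • (W' s * A))
    (fun s _ => (hf s).continuousAt.continuousWithinAt)
    (fun s _ => (hf s).hasDerivWithinAt) ?_ hΨ ?_ ⟨ht, le_rfl⟩
  · rw [key]
    simpa [heisenberg, propagator_zero] using h0
  · intro s hs
    refine le_trans ?_ (hb s hs.1)
    rw [← hWn]
    calc ‖A * W' s + σ • (W' s * A)‖ ≤ ‖A * W' s‖ + ‖σ • (W' s * A)‖ := norm_add_le _ _
      _ ≤ ‖A‖ * ‖W' s‖ + 1 * (‖W' s‖ * ‖A‖) := by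
        rw [norm_smul]
        gcongr <;> exact norm_mul_le _ _
      _ = _ := by ring

end Propagator

section LiebRobinson

variable {𝒜 : Type*} [NormedRing 𝒜] [StarRing 𝒜] [CStarRing 𝒜] [NormedAlgebra ℂ 𝒜]
  [StarModule ℂ 𝒜] [CompleteSpace 𝒜] {V : Type*} [DecidableEq V]

/-- Terms touching `Z` are dominated by the sum over the sites of `Z`. -/
theorem sum_not_disjoint_le (S : Finset (Finset V)) (Z : Finset V) (a : Finset V → ℝ)
    (ha : ∀ W, 0 ≤ a W) :
    ∑ W ∈ S with ¬ Disjoint W Z, a W ≤ ∑ z ∈ Z, ∑ W ∈ S with z ∈ W, a W := by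
  have : ∑ z ∈ Z, ∑ W ∈ S with z ∈ W, a W = ∑ W ∈ S, ∑ z ∈ Z with z ∈ W, a W := by
    simp only [Finset.sum_filter]
    exact Finset.sum_comm
  rw [this, Finset.sum_filter]
  refine Finset.sum_le_sum fun W _ => ?_
  by_cases h : Disjoint W Z
  · rw [if_neg (not_not_intro h)]
    exact Finset.sum_nonneg fun _ _ => ha W
  · rw [if_pos h]
    obtain ⟨z, hzW, hzZ⟩ := Finset.not_disjoint_iff.1 h
    exact Finset.single_le_sum (f := fun _ => a W) (fun _ _ => ha W)
      (Finset.mem_filter.2 ⟨hzZ, hzW⟩)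

/-- Splitting off the terms of the Hamiltonian that meet `X` in the evolution of `A`. -/
theorem norm_twisted_commutator_sum_le {S : Finset (Finset V)} {h : Finset V → 𝒜}
    (hsa : ∀ Z, IsSelfAdjoint (h Z)) {X : Finset V} {A B : 𝒜} {σ : ℂ} (hσ : ‖σ‖ ≤ 1)
    (hA : ∀ Z ∈ S, Disjoint Z X → Commute (h Z) A) {Ψ Ψ' : ℝ → ℝ}
    (h0 : ‖A * B + σ • (B * A)‖ ≤ Ψ 0) (hΨ : ∀ t, HasDerivAt Ψ (Ψ' t) t)
    (hb : ∀ t, 0 ≤ t → 2 * ‖A‖ * ∑ Z ∈ S with ¬ Disjoint Z X,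
      ‖heisenberg (∑ Z ∈ S, h Z) t (h Z) * B - B * heisenberg (∑ Z ∈ S, h Z) t (h Z)‖ ≤ Ψ' t)
    {t : ℝ} (ht : 0 ≤ t) :
    ‖heisenberg (∑ Z ∈ S, h Z) t A * B + σ • (B * heisenberg (∑ Z ∈ S, h Z) t A)‖ ≤ Ψ t := by
  have hsum : ∑ Z ∈ S, h Z = (∑ Z ∈ S with Disjoint Z X, h Z) + ∑ Z ∈ S with ¬ Disjoint Z X, h Z :=
    (Finset.sum_filter_add_sum_filter_not _ _ _).symm
  have hH : IsSelfAdjoint (∑ Z ∈ S, h Z) := isSelfAdjoint_sum _ fun Z _ => hsa Z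
  rw [hsum] at hb hH ⊢
  refine norm_twisted_commutator_le hσ (isSelfAdjoint_sum _ fun Z _ => hsa Z) hH ?_ h0 hΨ ?_ ht
  · refine Commute.sum_left _ _ _ fun Z hZ => ?_
    exact hA Z (Finset.mem_filter.1 hZ).1 (Finset.mem_filter.1 hZ).2
  · intro t ht
    refine le_trans ?_ (hb t ht)
    gcongr
    simp only [heisenberg, Finset.mul_sum, Finset.sum_mul, ← Finset.sum_sub_distrib]
    exact norm_sum_le _ _

/-- The Lieb–Robinson bound in terms of a weight `u` on the sites: `u` dominates the interaction of a
site with `Y` and is almost invariant under the interaction. -/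
theorem lieb_robinson {Λ : Finset V} {h : Finset V → 𝒜}
    (hsa : ∀ Z, IsSelfAdjoint (h Z))
    (hh : ∀ Z Z', Disjoint Z Z' → Commute (h Z) (h Z')) {X Y : Finset V} (hX : X ⊆ Λ)
    {A B : 𝒜} {σ : ℂ} (hσ : ‖σ‖ ≤ 1) (hA : ∀ Z, Disjoint Z X → Commute (h Z) A)
    (hB : ∀ Z, Disjoint Z Y → Commute (h Z) B) (hAB : A * B + σ • (B * A) = 0)
    {u : V → ℝ} (hu : ∀ z, 0 ≤ u z) {κ : ℝ} (hκ : 0 ≤ κ)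
    (h1 : ∀ z ∈ Λ, ∑ Z ∈ Λ.powerset with z ∈ Z, ‖h Z‖ * (if Disjoint Z Y then 0 else 1) ≤ κ * u z)
    (h2 : ∀ z ∈ Λ, ∑ Z ∈ Λ.powerset with z ∈ Z, ‖h Z‖ * ∑ z' ∈ Z, u z' ≤ κ * u z)
    {t : ℝ} (ht : 0 ≤ t) :
    ‖heisenberg (∑ Z ∈ Λ.powerset, h Z) t A * B
        + σ • (B * heisenberg (∑ Z ∈ Λ.powerset, h Z) t A)‖ ≤
      2 * ‖A‖ * ‖B‖ * (∑ x ∈ X, u x) * (Real.exp (2 * κ * t) - 1) := by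
  set S := Λ.powerset with hS
  set H := ∑ Z ∈ S, h Z with hHdef
  have hHsa : IsSelfAdjoint H := isSelfAdjoint_sum _ fun Z _ => hsa Z
  set c : ℝ := 2 * ∑ Z ∈ S, ‖h Z‖ with hc
  have hc0 : 0 ≤ c := by positivity
  let ι : Finset V → ℝ := fun Z => if Disjoint Z Y then 0 else 1
  have hι : ∀ Z, 0 ≤ ι Z := fun Z => by simp only [ι]; split_ifs <;> simp
  -- the contribution of the terms that meet `Z`
  have hstep : ∀ Z ⊆ Λ, ∀ w : ℝ, 0 ≤ w → ∑ Z' ∈ S with ¬ Disjoint Z' Z,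
      ‖h Z'‖ * (ι Z' + (∑ z ∈ Z', u z) * w) ≤ κ * (∑ z ∈ Z, u z) * (1 + w) := by
    intro Z hZ w hw
    refine (sum_not_disjoint_le S Z _ fun W => ?_).trans ?_
    · have := hι W
      have : 0 ≤ ∑ z ∈ W, u z := Finset.sum_nonneg fun z _ => hu z
      positivity
    · rw [Finset.mul_sum, Finset.sum_mul]
      refine Finset.sum_le_sum fun z hz => ?_
      have a1 := h1 z (hZ hz)
      have a2 := mul_le_mul_of_nonneg_right (h2 z (hZ hz)) hw
      rw [Finset.sum_mul] at a2
      calc _ = ∑ W ∈ S with z ∈ W, ‖h W‖ * ι W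
              + ∑ W ∈ S with z ∈ W, ‖h W‖ * (∑ z' ∈ W, u z') * w := by
            rw [← Finset.sum_add_distrib]
            refine Finset.sum_congr rfl fun W _ => by ring
        _ ≤ κ * u z + κ * u z * w := add_le_add a1 a2
        _ = _ := by ring
  have hexp : ∀ s, HasDerivAt (fun s => Real.exp (2 * κ * s) - 1)
      (2 * κ * Real.exp (2 * κ * s)) s := by
    intro s
    have := ((hasDerivAt_id s).const_mul (2 * κ)).exp.sub_const 1
    simpa [mul_comm] using this
  have hw0 : ∀ s, 0 ≤ s → 0 ≤ Real.exp (2 * κ * s) - 1 := by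
    intro s hs
    have := Real.one_le_exp (x := 2 * κ * s) (by positivity)
    linarith
  have hu' : ∀ Z : Finset V, 0 ≤ ∑ z ∈ Z, u z := fun Z => Finset.sum_nonneg fun z _ => hu z
  have hpow : ∀ (k : ℕ) (s : ℝ), HasDerivAt (fun s => (c * s) ^ (k + 1) / (k + 1).factorial)
      (c * ((c * s) ^ k / k.factorial)) s := by
    intro k s
    have := (((hasDerivAt_id s).const_mul c).pow (k + 1)).div_const ((k + 1).factorial : ℝ)
    refine this.congr_deriv ?_
    have hk : (k.factorial : ℝ) ≠ 0 := by positivity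
    rw [Nat.factorial_succ]
    push_cast
    simp only [id]
    field_simp
  have hiter : ∀ (k : ℕ) (Z : Finset V), Z ⊆ Λ → ∀ s : ℝ, 0 ≤ s →
      ‖heisenberg H s (h Z) * B - B * heisenberg H s (h Z)‖ ≤ 2 * ‖h Z‖ * ‖B‖ *
        (ι Z + (∑ z ∈ Z, u z) * (Real.exp (2 * κ * s) - 1) + (c * s) ^ k / k.factorial) := by
    intro k
    induction k with
    | zero =>
      intro Z _ s hs
      have e1 : ‖heisenberg H s (h Z) * B - B * heisenberg H s (h Z)‖ ≤ 2 * ‖h Z‖ * ‖B‖ * 1 := by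
        refine (norm_sub_le _ _).trans ?_
        have e1 := norm_mul_le (heisenberg H s (h Z)) B
        have e2 := norm_mul_le B (heisenberg H s (h Z))
        rw [norm_heisenberg hHsa] at e1 e2
        linarith
      refine e1.trans (mul_le_mul_of_nonneg_left ?_ (by positivity))
      have := mul_nonneg (hu' Z) (hw0 s hs)
      have := hι Z
      simp only [pow_zero, Nat.factorial_zero, Nat.cast_one, div_one]
      linarith
    | succ k ih =>
      intro Z hZ s hs
      have main := norm_twisted_commutator_sum_le (S := S) hsa (X := Z) (A := h Z) (B := B)
        (σ := -1) (by simp) (fun Z' _ hd => hh Z' Z hd)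
        (Ψ := fun s => 2 * ‖h Z‖ * ‖B‖ * (ι Z + (∑ z ∈ Z, u z) * (Real.exp (2 * κ * s) - 1)
          + (c * s) ^ (k + 1) / (k + 1).factorial))
        (Ψ' := fun s => 2 * ‖h Z‖ * ‖B‖ * ((∑ z ∈ Z, u z) * (2 * κ * Real.exp (2 * κ * s))
          + c * ((c * s) ^ k / k.factorial))) ?_ ?_ ?_ hs
      · simpa [sub_eq_add_neg] using main
      · by_cases hd : Disjoint Z Y
        · have := (hB Z hd).eq
          simp [this, ι, hd]
        · have e1 := norm_mul_le (h Z) B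
          have e2 := norm_mul_le B (h Z)
          have e3 := norm_sub_le (h Z * B) (B * h Z)
          simp [ι, hd, ← sub_eq_add_neg]
          linarith
      · intro s
        exact ((((hexp s).const_mul _).const_add _).add (hpow k s)).const_mul _
      · intro s hs
        have hsum : ∑ Z' ∈ S with ¬ Disjoint Z' Z,
            ‖heisenberg H s (h Z') * B - B * heisenberg H s (h Z')‖ ≤
            2 * ‖B‖ * (κ * (∑ z ∈ Z, u z) * Real.exp (2 * κ * s)
              + (∑ Z' ∈ S, ‖h Z'‖) * ((c * s) ^ k / k.factorial)) := by
          have q0 : 0 ≤ (c * s) ^ k / k.factorial := by positivity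
          calc _ ≤ ∑ Z' ∈ S with ¬ Disjoint Z' Z, (2 * ‖B‖ * (‖h Z'‖ *
                (ι Z' + (∑ z ∈ Z', u z) * (Real.exp (2 * κ * s) - 1)))
                + 2 * ‖B‖ * (‖h Z'‖ * ((c * s) ^ k / k.factorial))) := by
                refine Finset.sum_le_sum fun Z' hZ' => ?_
                have := ih Z' (Finset.mem_powerset.1 (Finset.mem_filter.1 hZ').1) s hs
                refine this.trans (le_of_eq (by ring))
            _ = 2 * ‖B‖ * ((∑ Z' ∈ S with ¬ Disjoint Z' Z, ‖h Z'‖ *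
                (ι Z' + (∑ z ∈ Z', u z) * (Real.exp (2 * κ * s) - 1)))
                + ∑ Z' ∈ S with ¬ Disjoint Z' Z, ‖h Z'‖ * ((c * s) ^ k / k.factorial)) := by
                rw [Finset.sum_add_distrib, ← Finset.mul_sum, ← Finset.mul_sum, mul_add]
            _ ≤ _ := by
                refine mul_le_mul_of_nonneg_left (add_le_add ?_ ?_) (by positivity)
                · simpa using hstep Z hZ _ (hw0 s hs)
                · rw [Finset.sum_mul]
                  exact Finset.sum_le_sum_of_subset_of_nonneg (Finset.filter_subset _ _)
                    fun _ _ _ => by positivity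
        have := mul_le_mul_of_nonneg_left hsum (by positivity : 0 ≤ 2 * ‖h Z‖)
        refine this.trans (le_of_eq ?_)
        rw [hc]
        ring
  have hlim : ∀ Z ⊆ Λ, ∀ s : ℝ, 0 ≤ s →
      ‖heisenberg H s (h Z) * B - B * heisenberg H s (h Z)‖ ≤ 2 * ‖h Z‖ * ‖B‖ *
        (ι Z + (∑ z ∈ Z, u z) * (Real.exp (2 * κ * s) - 1)) := by
    intro Z hZ s hs
    have hT := ((FloorSemiring.tendsto_pow_div_factorial_atTop (c * s)).const_add
      (ι Z + (∑ z ∈ Z, u z) * (Real.exp (2 * κ * s) - 1))).const_mul (2 * ‖h Z‖ * ‖B‖)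
    rw [add_zero] at hT
    exact ge_of_tendsto' hT fun k => hiter k Z hZ s hs
  refine norm_twisted_commutator_sum_le (S := S) hsa (X := X) hσ (fun Z _ hd => hA Z hd)
    (Ψ := fun s => 2 * ‖A‖ * ‖B‖ * (∑ x ∈ X, u x) * (Real.exp (2 * κ * s) - 1))
    (Ψ' := fun s => 2 * ‖A‖ * ‖B‖ * (∑ x ∈ X, u x) * (2 * κ * Real.exp (2 * κ * s)))
    (by simp [hAB]) (fun s => (hexp s).const_mul _) ?_ ht
  intro s hs
  have hsum : ∑ Z ∈ S with ¬ Disjoint Z X,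
      ‖heisenberg H s (h Z) * B - B * heisenberg H s (h Z)‖ ≤
      2 * ‖B‖ * (κ * (∑ z ∈ X, u z) * Real.exp (2 * κ * s)) := by
    have h3 := mul_le_mul_of_nonneg_left (hstep X hX _ (hw0 s hs))
      (by positivity : 0 ≤ 2 * ‖B‖)
    rw [Finset.mul_sum, add_sub_cancel] at h3
    refine (Finset.sum_le_sum fun Z hZ => ?_).trans h3
    exact (hlim Z (Finset.mem_powerset.1 (Finset.mem_filter.1 hZ).1) s hs).trans
      (le_of_eq (by ring))
  refine (mul_le_mul_of_nonneg_left hsum (by positivity : 0 ≤ 2 * ‖A‖)).trans (le_of_eq ?_)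
  ring

end LiebRobinson

section Adjoint

variable {C : Type*}

/-- The adjoint of a weighted composition operator is the one along the inverse partial map. -/
theorem star_weightedComp {f g : C → C} {a b : C → ℂ} (ha : ∀ s, ‖a s‖ ≤ 1)
    (hf : Set.InjOn f {s | a s ≠ 0}) (hb : ∀ s, ‖b s‖ ≤ 1) (hg : Set.InjOn g {s | b s ≠ 0})
    (hab : ∀ s, a s ≠ 0 → g (f s) = s ∧ b (f s) = starRingEnd ℂ (a s))
    (hba : ∀ s, b s ≠ 0 → f (g s) = s ∧ a (g s) = starRingEnd ℂ (b s)) :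
    star (weightedComp f a ha hf) = weightedComp g b hb hg := by
  rw [ContinuousLinearMap.star_eq_adjoint]
  symm
  rw [ContinuousLinearMap.eq_adjoint_iff]
  intro ξ ζ
  rw [lp.inner_eq_tsum, lp.inner_eq_tsum]
  simp only [weightedComp_apply, RCLike.inner_apply]
  refine tsum_eq_tsum_of_ne_zero_bij (fun s => f s.1) ?_ ?_ ?_
  · rintro ⟨s, hs⟩ ⟨t, ht⟩ h
    have hs' : a s ≠ 0 := fun h0 => hs (by simp [h0])
    have ht' : a t ≠ 0 := fun h0 => ht (by simp [h0])
    exact Subtype.ext (hf hs' ht' h)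
  · intro s hs
    have hs' : b s ≠ 0 := fun h0 => hs (by simp [h0])
    obtain ⟨h1, h2⟩ := hba s hs'
    refine ⟨⟨g s, ?_⟩, h1⟩
    rw [Function.mem_support] at hs ⊢
    simp only [h1, h2]
    simp only [map_mul, ne_eq, mul_eq_zero, not_or, map_eq_zero] at hs ⊢
    tauto
  · rintro ⟨s, hs⟩
    have hs' : a s ≠ 0 := fun h0 => hs (by simp [h0])
    obtain ⟨h1, h2⟩ := hab s hs'
    simp only [h1, h2, map_mul, Complex.conj_conj]
    ring

end Adjoint

section CAR

variable {V M : Type*} [DecidableEq V] [LinearOrder M]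

theorem card_filter_lt_insert {s : Finset M} {m m' : M} (h : m ∉ s) :
    ((insert m s).filter (· < m')).card = (s.filter (· < m')).card + if m < m' then 1 else 0 := by
  rw [Finset.filter_insert]
  split_ifs with hlt
  · rw [Finset.card_insert_of_notMem (by simp [h])]
  · rfl

/-- The creation operator of the mode `m`. -/
noncomputable def creation (d : V → ℕ) (m : M) : Op M d :=
  weightedComp (fun s => (s.1.erase m, s.2))
    (fun s => if m ∈ s.1 then (-1 : ℂ) ^ (s.1.filter (· < m)).card else 0)
    (fun s => by split_ifs <;> simp)
    (by
      rintro ⟨s, σ⟩ hs ⟨t, τ⟩ ht h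
      have hs' : m ∈ s := by
        by_contra hm
        exact hs (by simp [hm])
      have ht' : m ∈ t := by
        by_contra hm
        exact ht (by simp [hm])
      simp only [Prod.mk.injEq] at h
      refine Prod.ext ?_ h.2
      have := congrArg (fun u => insert m u) h.1
      simpa [Finset.insert_erase hs', Finset.insert_erase ht'] using this)

theorem star_annihilation (d : V → ℕ) (m : M) : star (annihilation d m) = creation d m := by
  refine star_weightedComp _ _ _ _ ?_ ?_
  · rintro ⟨s, σ⟩ h
    have hm : m ∉ s := fun hm => h (by simp [hm])
    simp [hm, Finset.filter_insert]
  · rintro ⟨s, σ⟩ h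
    have hm : m ∈ s := by
      by_contra hm
      exact h (by simp [hm])
    simp [hm, Finset.filter_erase]

theorem annihilation_anticomm (d : V → ℕ) {m m' : M} (h : m ≠ m') :
    annihilation d m * annihilation d m' = -(annihilation d m' * annihilation d m) := by
  ext ξ s
  obtain ⟨s, σ⟩ := s
  change _ * (_ * ξ _) = -(_ * (_ * ξ _))
  by_cases hm : m ∈ s
  · simp [hm]
  by_cases hm' : m' ∈ s
  · simp [hm']
  simp only [hm, hm', Finset.mem_insert, h, h.symm, or_self, if_false,
    card_filter_lt_insert hm, card_filter_lt_insert hm', Finset.insert_comm m m' s]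
  rcases lt_or_gt_of_ne h with hl | hl
  · simp [hl, hl.not_gt, pow_add]; ring
  · simp [hl, hl.not_gt, pow_add]; ring

theorem creation_annihilation_anticomm (d : V → ℕ) {m m' : M} (h : m ≠ m') :
    creation d m * annihilation d m' = -(annihilation d m' * creation d m) := by
  ext ξ s
  obtain ⟨s, σ⟩ := s
  change _ * (_ * ξ _) = -(_ * (_ * ξ _))
  by_cases hm' : m' ∈ s
  · simp [hm', h.symm]
  by_cases hm : m ∈ s
  · obtain ⟨t, ht, rfl⟩ : ∃ t, m ∉ t ∧ insert m t = s :=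
      ⟨s.erase m, by simp, Finset.insert_erase hm⟩
    have hm't : m' ∉ t := fun hc => hm' (Finset.mem_insert_of_mem hc)
    have e1 : (insert m t).erase m = t := Finset.erase_insert ht
    have e2 : (insert m' (insert m t)).erase m = insert m' t := by
      rw [Finset.insert_comm, Finset.erase_insert]
      simp [h, ht]
    simp only [e1, e2, hm', hm't, Finset.mem_insert_self, Finset.mem_insert, or_true,
      if_true, if_false, card_filter_lt_insert ht, card_filter_lt_insert hm']
    rcases lt_or_gt_of_ne h with hl | hl
    · simp [hl, hl.not_gt, pow_add]; ring
    · simp [hl, hl.not_gt, pow_add]; ring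
  · simp [hm, h]

theorem parity_annihilation (d : V → ℕ) (m : M) :
    parity M d * annihilation d m = -(annihilation d m * parity M d) := by
  ext ξ s
  obtain ⟨s, σ⟩ := s
  change _ * (_ * ξ _) = -(_ * (_ * ξ _))
  by_cases hm : m ∈ s
  · simp [hm]
  · simp [hm, Finset.card_insert_of_notMem hm, pow_add]
    ring

theorem parity_mul_self (d : V → ℕ) : parity M d * parity M d = 1 := by
  ext ξ s
  change _ * (_ * ξ _) = ξ s
  simp only [id]
  rw [← mul_assoc, ← mul_pow]
  simp

theorem star_parity (d : V → ℕ) : star (parity M d) = parity M d := by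
  refine star_weightedComp _ _ _ _ ?_ ?_ <;> simp

theorem star_spinUnit (d : V → ℕ) (x : V) (a b : Fin (d x + 1)) :
    star (spinUnit M d x a b) = spinUnit M d x b a := by
  have key : ∀ (a b : Fin (d x + 1)) (s : Config M d), (if s.2 x = a then (1 : ℂ) else 0) ≠ 0 →
      ((s.1, (s.2.update x b).update x a) : Config M d) = s := by
    rintro a b ⟨s, σ⟩ h
    have h' : σ x = a := by
      by_contra hc
      exact h (by simp [hc])
    refine Prod.ext rfl (DFinsupp.ext fun y => ?_)
    by_cases hy : y = x
    · subst hy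
      simp [h']
    · simp [DFinsupp.coe_update, Function.update_of_ne hy]
  refine star_weightedComp _ _ _ _ ?_ ?_
  · intro s h
    refine ⟨key a b s h, ?_⟩
    have : s.2 x = a := by
      by_contra hc
      exact h (by simp [hc])
    simp [this]
  · intro s h
    refine ⟨key b a s h, ?_⟩
    have : s.2 x = b := by
      by_contra hc
      exact h (by simp [hc])
    simp [this]

theorem parity_spinUnit (d : V → ℕ) (x : V) (a b : Fin (d x + 1)) :
    Commute (parity M d) (spinUnit M d x a b) := by
  ext ξ s
  change _ * (_ * ξ _) = _ * (_ * ξ _)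
  simp only [id]
  ring

theorem annihilation_spinUnit (d : V → ℕ) (m : M) (x : V) (a b : Fin (d x + 1)) :
    Commute (annihilation d m) (spinUnit M d x a b) := by
  ext ξ s
  change _ * (_ * ξ _) = _ * (_ * ξ _)
  simp only
  ring

theorem spinUnit_spinUnit (d : V → ℕ) {x y : V} (h : x ≠ y) (a b : Fin (d x + 1))
    (a' b' : Fin (d y + 1)) : Commute (spinUnit M d x a b) (spinUnit M d y a' b') := by
  ext ξ s
  change _ * (_ * ξ _) = _ * (_ * ξ _)
  have : (s.2.update x b).update y b' = (s.2.update y b').update x b := by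
    refine DFinsupp.ext fun z => ?_
    simp only [DFinsupp.coe_update]
    rw [Function.update_comm h]
  simp only [this, DFinsupp.coe_update, Function.update_of_ne h, Function.update_of_ne h.symm]
  ring

/-- Observables with support in `Z` commute with `P a_m` for the modes `m` off `Z`. -/
theorem localAlgebra_le_centralizer_klein (site : M → V) (d : V → ℕ) {Z : Finset V} {m : M}
    (hm : site m ∉ Z) :
    localAlgebra site d Z ≤ StarSubalgebra.centralizer ℂ {parity M d * annihilation d m} := by
  refine StarAlgebra.adjoin_le ?_
  rintro T (⟨m', hm', rfl⟩ | ⟨x, hx, a, b, rfl⟩)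
  · have hne : m ≠ m' := by
      rintro rfl
      exact hm hm'
    rw [SetLike.mem_coe, StarSubalgebra.mem_centralizer_iff]
    rintro _ rfl
    rw [star_mul, star_parity, star_annihilation]
    constructor
    · calc parity M d * annihilation d m * annihilation d m'
          = -(parity M d * annihilation d m') * annihilation d m := by
            rw [mul_assoc, annihilation_anticomm d hne]
            noncomm_ring
        _ = _ := by
            rw [parity_annihilation]
            noncomm_ring
    · calc creation d m * parity M d * annihilation d m'
          = -(creation d m * annihilation d m') * parity M d := by
            rw [mul_assoc, parity_annihilation]
            noncomm_ring
        _ = _ := by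
            rw [creation_annihilation_anticomm d hne]
            noncomm_ring
  · rw [SetLike.mem_coe, StarSubalgebra.mem_centralizer_iff]
    rintro _ rfl
    rw [star_mul, star_parity]
    have h1 := parity_spinUnit (M := M) d x a b
    have h2 := annihilation_spinUnit d m x a b
    have h3 : Commute (star (annihilation d m)) (spinUnit M d x a b) := by
      have := (annihilation_spinUnit d m x b a).star_star
      rwa [star_spinUnit] at this
    exact ⟨h1.mul_left h2, h3.mul_left h1⟩

theorem localAlgebra_le_centralizer_spinUnit (site : M → V) (d : V → ℕ) {Z : Finset V} {x : V}
    (hx : x ∉ Z) (a b : Fin (d x + 1)) :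
    localAlgebra site d Z ≤ StarSubalgebra.centralizer ℂ {spinUnit M d x a b} := by
  refine StarAlgebra.adjoin_le ?_
  rintro T (⟨m', hm', rfl⟩ | ⟨y, hy, a', b', rfl⟩)
  · rw [SetLike.mem_coe, StarSubalgebra.mem_centralizer_iff]
    rintro _ rfl
    rw [star_spinUnit]
    exact ⟨(annihilation_spinUnit d m' x a b).symm, (annihilation_spinUnit d m' x b a).symm⟩
  · have hne : x ≠ y := by
      rintro rfl
      exact hx hy
    rw [SetLike.mem_coe, StarSubalgebra.mem_centralizer_iff]
    rintro _ rfl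
    rw [star_spinUnit]
    exact ⟨spinUnit_spinUnit d hne _ _ _ _, spinUnit_spinUnit d hne _ _ _ _⟩

/-- An even observable commutes with the observables of a disjoint region. -/
theorem commute_of_even (site : M → V) (d : V → ℕ) {Z Y : Finset V} (hZY : Disjoint Z Y)
    {T B : Op M d} (hT : T ∈ localAlgebra site d Z) (heven : Commute (parity M d) T)
    (hB : B ∈ localAlgebra site d Y) : Commute T B := by
  have main : ∀ T ∈ localAlgebra site d Z, Commute (parity M d) T → ∀ g ∈
      ({T | ∃ m, site m ∈ Y ∧ T = annihilation d m} ∪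
        {T | ∃ x ∈ Y, ∃ a b, T = spinUnit M d x a b} : Set (Op M d)), Commute T g := by
    rintro T hT heven g (⟨m, hm, rfl⟩ | ⟨x, hx, a, b, rfl⟩)
    · have hmZ : site m ∉ Z := fun h => Finset.disjoint_left.1 hZY h hm
      have h1 := ((StarSubalgebra.mem_centralizer_iff ℂ).1
        (localAlgebra_le_centralizer_klein site d hmZ hT) _ rfl).1
      have h2 : Commute T (parity M d * (parity M d * annihilation d m)) :=
        heven.symm.mul_right h1.symm
      rwa [← mul_assoc, parity_mul_self, one_mul] at h2
    · have hxZ : x ∉ Z := fun h => Finset.disjoint_left.1 hZY h hx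
      exact ((StarSubalgebra.mem_centralizer_iff ℂ).1
        (localAlgebra_le_centralizer_spinUnit site d hxZ a b hT) _ rfl).1.symm
  have hle : localAlgebra site d Y ≤ StarSubalgebra.centralizer ℂ {T} := by
    refine StarAlgebra.adjoin_le ?_
    intro g hg
    rw [SetLike.mem_coe, StarSubalgebra.mem_centralizer_iff]
    rintro _ rfl
    refine ⟨main _ hT heven g hg, main _ (star_mem hT) ?_ g hg⟩
    have := heven.star_star
    rwa [star_parity] at this
  exact ((StarSubalgebra.mem_centralizer_iff ℂ).1 (hle hB) _ rfl).1

/-- The basis states of the state space of a region. -/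
def InRegion (site : M → V) (d : V → ℕ) (X : Finset V) (s : Config M d) : Prop :=
  (∀ m ∈ s.1, site m ∈ X) ∧ ∀ x, s.2 x ≠ 0 → x ∈ X

open Classical in
/-- The orthogonal projection onto the state space of a region. -/
noncomputable def regionProj (site : M → V) (d : V → ℕ) (X : Finset V) : Op M d :=
  weightedComp id
    (fun s => if InRegion site d X s then 1 else 0)
    (fun s => by split_ifs <;> simp) (Set.injOn_id _)

theorem star_regionProj (site : M → V) (d : V → ℕ) (X : Finset V) :
    star (regionProj site d X) = regionProj site d X := by
  refine star_weightedComp _ _ _ _ ?_ ?_ <;>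
  · intro s hs
    refine ⟨rfl, ?_⟩
    simp only [id]
    split_ifs <;> simp

theorem mem_regionSpace_iff (site : M → V) (d : V → ℕ) (X : Finset V) (ξ : Hilb M d) :
    ξ ∈ regionSpace site d X ↔ regionProj site d X ξ = ξ := by
  constructor
  · intro h
    ext s
    change _ * ξ s = ξ s
    by_cases hs : InRegion site d X s
    · simp [hs]
    · rw [h s hs, mul_zero]
  · intro h s hs
    have h1 : (regionProj site d X ξ) s = ξ s := by rw [h]
    rw [← h1]
    change _ * ξ s = 0
    have hs' : ¬ InRegion site d X s := hs
    simp [hs']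

theorem localAlgebra_le_centralizer_regionProj (site : M → V) (d : V → ℕ) {X Λ : Finset V}
    (hX : X ⊆ Λ) :
    localAlgebra site d X ≤ StarSubalgebra.centralizer ℂ {regionProj site d Λ} := by
  have main : ∀ g ∈
      ({T | ∃ m, site m ∈ X ∧ T = annihilation d m} ∪
        {T | ∃ x ∈ X, ∃ a b, T = spinUnit M d x a b} : Set (Op M d)),
      Commute (regionProj site d Λ) g := by
    rintro g (⟨m, hm, rfl⟩ | ⟨x, hx, a, b, rfl⟩)
    · ext ξ s
      change _ * (_ * ξ _) = _ * (_ * ξ _)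
      have hm' := hX hm
      have e : InRegion site d Λ (insert m s.1, s.2) ↔ InRegion site d Λ s := by
        simp only [InRegion, Finset.mem_insert, forall_eq_or_imp, hm', true_and]
      by_cases hr : InRegion site d Λ s
      · have hr' := e.2 hr
        simp [hr, hr']
      · have hr' := fun hc => hr (e.1 hc)
        simp only [id, if_neg hr, zero_mul]
        refine (mul_eq_zero_of_right _ ?_).symm
        exact mul_eq_zero_of_left (if_neg hr') _
    · ext ξ s
      change _ * (_ * ξ _) = _ * (_ * ξ _)
      have hx' := hX hx
      have e' : (∀ y, (s.2.update x b) y ≠ 0 → y ∈ Λ) ↔ ∀ y, s.2 y ≠ 0 → y ∈ Λ := by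
        refine forall_congr' fun y => ?_
        by_cases hy : y = x
        · subst hy
          simp [hx']
        · simp [DFinsupp.coe_update, Function.update_of_ne hy]
      have e : InRegion site d Λ (s.1, s.2.update x b) ↔ InRegion site d Λ s :=
        and_congr_right' e'
      by_cases hr : InRegion site d Λ s
      · have hr' := e.2 hr
        simp [hr, hr']
      · have hr' := fun hc => hr (e.1 hc)
        simp only [id, if_neg hr, zero_mul]
        refine (mul_eq_zero_of_right _ ?_).symm
        exact mul_eq_zero_of_left (if_neg hr') _
  refine StarAlgebra.adjoin_le fun g hg => ?_
  rw [SetLike.mem_coe, StarSubalgebra.mem_centralizer_iff]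
  rintro _ rfl
  rw [star_regionProj]
  exact ⟨main g hg, main g hg⟩

/-- Observables of a region preserve the state space of any larger region. -/
theorem apply_mem_regionSpace (site : M → V) (d : V → ℕ) {X Λ : Finset V} (hX : X ⊆ Λ)
    {T : Op M d} (hT : T ∈ localAlgebra site d X) {ξ : Hilb M d}
    (hξ : ξ ∈ regionSpace site d Λ) : T ξ ∈ regionSpace site d Λ := by
  have h := ((StarSubalgebra.mem_centralizer_iff ℂ).1
    (localAlgebra_le_centralizer_regionProj site d hX hT) _ rfl).1
  rw [mem_regionSpace_iff] at hξ ⊢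
  calc regionProj site d Λ (T ξ) = (regionProj site d Λ * T) ξ := rfl
    _ = T (regionProj site d Λ ξ) := by rw [h]; rfl
    _ = T ξ := by rw [hξ]

end CAR

section Distance

variable {V : Type*}

theorem setDist_le (G : SimpleGraph V) {X Y : Finset V} {x y : V} (hx : x ∈ X) (hy : y ∈ Y) :
    setDist G X Y ≤ G.dist x y :=
  Nat.sInf_le ⟨x, hx, y, hy, rfl⟩

theorem disjoint_of_setDist_pos (G : SimpleGraph V) {X Y : Finset V} (h : 0 < setDist G X Y) :
    Disjoint X Y := by
  rw [Finset.disjoint_left]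
  intro x hx hy
  have := setDist_le G hx hy
  rw [SimpleGraph.dist_self] at this
  omega

theorem dist_le_setDiam (G : SimpleGraph V) {X : Finset V} {x y : V} (hx : x ∈ X) (hy : y ∈ X) :
    G.dist x y ≤ setDiam G X :=
  Finset.le_sup (f := fun p : V × V => G.dist p.1 p.2) (b := (x, y)) (Finset.mk_mem_product hx hy)

theorem dist_triangle_of_reachable {G : SimpleGraph V} {x y z : V} (hxy : G.Reachable x y)
    (hyz : G.Reachable y z) : G.dist x z ≤ G.dist x y + G.dist y z := by
  have h := G.edist_triangle (u := x) (v := y) (w := z)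
  rw [← hxy.coe_dist_eq_edist, ← hyz.coe_dist_eq_edist,
    ← (hxy.trans hyz).coe_dist_eq_edist] at h
  exact_mod_cast h

end Distance

namespace LatticeSystem

variable {V M : Type*} [DecidableEq V] [LinearOrder M] (L : LatticeSystem V M)

theorem isSelfAdjoint_hamiltonian (n : ℕ) : IsSelfAdjoint (L.hamiltonian n) :=
  isSelfAdjoint_sum _ fun Z _ => L.h_selfAdjoint n Z

theorem evolve_eq_heisenberg (n : ℕ) (t : ℝ) (A : Op M L.d) :
    L.evolve n t A = heisenberg (L.hamiltonian n) t A := by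
  rw [evolve, heisenberg, propagator, propagator, Complex.ofReal_neg, mul_neg]

theorem dist_triangle (n : ℕ) {x y z : V} (hx : x ∈ L.Λ n) (hy : y ∈ L.Λ n) (hz : z ∈ L.Λ n) :
    (L.bonds n).dist x z ≤ (L.bonds n).dist x y + (L.bonds n).dist y z :=
  dist_triangle_of_reachable (L.connected n x hx y hy) (L.connected n y hy z hz)

/-- Summing a function over the supports containing `z`, weighted by the interaction. -/
theorem sum_norm_mul_sum (n : ℕ) (z : V) (f : V → ℝ) :
    ∑ Z ∈ (L.Λ n).powerset with z ∈ Z, ‖L.h n Z‖ * ∑ z' ∈ Z, f z' =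
      ∑ z' ∈ L.Λ n, L.pairStrength n z z' * f z' := by
  have e : ∀ Z ∈ (L.Λ n).powerset.filter (z ∈ ·), ‖L.h n Z‖ * ∑ z' ∈ Z, f z'
      = ∑ z' ∈ L.Λ n, if z' ∈ Z then ‖L.h n Z‖ * f z' else 0 := by
    intro Z hZ
    have hZ' : Z ⊆ L.Λ n := Finset.mem_powerset.1 (Finset.mem_filter.1 hZ).1
    rw [← Finset.sum_filter, Finset.filter_mem_eq_inter, Finset.inter_eq_right.2 hZ',
      Finset.mul_sum]
  rw [Finset.sum_congr rfl e, Finset.sum_comm]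
  refine Finset.sum_congr rfl fun z' _ => ?_
  rw [pairStrength, Finset.sum_mul, ← Finset.sum_filter, Finset.filter_filter]

/-- A group velocity bound from a decay function that is reproduced by the interaction. -/
theorem groupVelocityBound_of_decay {g : ℕ → ℝ} (hg : ∀ r, 0 ≤ g r) (hanti : Antitone g) {κ : ℝ}
    (hκ : 0 ≤ κ)
    (h1 : ∀ n, ∀ z ∈ L.Λ n, ∀ y ∈ L.Λ n, L.pairStrength n z y ≤ κ * g ((L.bonds n).dist z y))
    (h2 : ∀ n, ∀ z ∈ L.Λ n, ∀ y ∈ L.Λ n,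
      ∑ z' ∈ L.Λ n, L.pairStrength n z z' * g ((L.bonds n).dist z' y)
        ≤ κ * g ((L.bonds n).dist z y)) :
    L.GroupVelocityBound g (2 * κ) := by
  refine ⟨2, by norm_num, ?_⟩
  intro n X Y A B t hX hY hdist
  have hdisj := disjoint_of_setDist_pos _ hdist
  have key : ∀ σ : ℂ, ‖σ‖ ≤ 1 → A ∈ L.obs X → B ∈ L.obs Y → A * B + σ • (B * A) = 0 →
      ‖L.evolve n t A * B + σ • (B * L.evolve n t A)‖ ≤
        2 * ‖A‖ * ‖B‖ * X.card * Y.card * g (setDist (L.bonds n) X Y) *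
          (Real.exp (2 * κ * |t|) - 1) := by
    intro σ hσ hA hB hAB
    let u : V → ℝ := fun z => ∑ y ∈ Y, g ((L.bonds n).dist z y)
    have hu : ∀ z, 0 ≤ u z := fun z => Finset.sum_nonneg fun _ _ => hg _
    have hu1 : ∀ z ∈ L.Λ n, ∑ Z ∈ (L.Λ n).powerset with z ∈ Z,
        ‖L.h n Z‖ * (if Disjoint Z Y then 0 else 1) ≤ κ * u z := by
      intro z hz
      calc _ ≤ ∑ Z ∈ (L.Λ n).powerset with z ∈ Z,
              ‖L.h n Z‖ * ∑ z' ∈ Z, if z' ∈ Y then 1 else 0 := by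
            gcongr with Z hZ
            split_ifs with hd
            · exact Finset.sum_nonneg fun _ _ => by split_ifs <;> norm_num
            · obtain ⟨y, hyZ, hyY⟩ := Finset.not_disjoint_iff.1 hd
              refine le_trans (by simp [hyY]) (Finset.single_le_sum
                (f := fun z' => if z' ∈ Y then (1 : ℝ) else 0)
                (fun _ _ => by split_ifs <;> norm_num) hyZ)
        _ = ∑ y ∈ Y, L.pairStrength n z y := by
            rw [sum_norm_mul_sum]
            simp only [mul_ite, mul_one, mul_zero]
            rw [← Finset.sum_filter, Finset.filter_mem_eq_inter, Finset.inter_eq_right.2 hY]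
        _ ≤ _ := by
            rw [Finset.mul_sum]
            exact Finset.sum_le_sum fun y hy => h1 n z hz y (hY hy)
    have hu2 : ∀ z ∈ L.Λ n, ∑ Z ∈ (L.Λ n).powerset with z ∈ Z,
        ‖L.h n Z‖ * ∑ z' ∈ Z, u z' ≤ κ * u z := by
      intro z hz
      rw [sum_norm_mul_sum]
      simp only [u, Finset.mul_sum]
      rw [Finset.sum_comm]
      exact Finset.sum_le_sum fun y hy => h2 n z hz y (hY hy)
    have hsumu : ∑ x ∈ X, u x ≤ X.card * Y.card * g (setDist (L.bonds n) X Y) := by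
      calc _ ≤ ∑ x ∈ X, ∑ y ∈ Y, g (setDist (L.bonds n) X Y) :=
            Finset.sum_le_sum fun x hx => Finset.sum_le_sum fun y hy =>
              hanti (setDist_le _ hx hy)
        _ = _ := by simp [mul_assoc]
    have hcomm : ∀ (W : Finset V) (T : Op M L.d), T ∈ L.obs W → ∀ Z, Disjoint Z W →
        Commute (L.h n Z) T := fun W T hT Z hd =>
      commute_of_even L.site L.d hd (L.h_mem n Z) (L.h_even n Z) hT
    have main : ‖L.evolve n t A * B + σ • (B * L.evolve n t A)‖ ≤
        2 * ‖A‖ * ‖B‖ * (∑ x ∈ X, u x) * (Real.exp (2 * κ * |t|) - 1) := by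
      rw [evolve_eq_heisenberg]
      rcases le_total 0 t with ht | ht
      · rw [abs_of_nonneg ht]
        exact lieb_robinson (L.h_selfAdjoint n)
          (fun Z Z' hd => hcomm Z' _ (L.h_mem n Z') Z hd) hX hσ (hcomm X A hA) (hcomm Y B hB) hAB
          hu hκ hu1 hu2 ht
      · have h := lieb_robinson (h := fun Z => -L.h n Z) (fun Z => (L.h_selfAdjoint n Z).neg)
          (fun Z Z' hd => (hcomm Z' _ (L.h_mem n Z') Z hd).neg_left.neg_right) hX hσ
          (fun Z hd => (hcomm X A hA Z hd).neg_left) (fun Z hd => (hcomm Y B hB Z hd).neg_left) hAB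
          hu hκ (by simpa using hu1) (by simpa using hu2) (neg_nonneg.2 ht)
        have e : heisenberg (∑ Z ∈ (L.Λ n).powerset, -L.h n Z) (-t) A
            = heisenberg (L.hamiltonian n) t A := by
          simp [heisenberg, propagator, hamiltonian]
        rw [abs_of_nonpos ht, ← e]
        exact h
    have hexp : 0 ≤ Real.exp (2 * κ * |t|) - 1 :=
      sub_nonneg.2 (Real.one_le_exp (by positivity))
    calc _ ≤ _ := main
      _ ≤ 2 * ‖A‖ * ‖B‖ * (X.card * Y.card * g (setDist (L.bonds n) X Y)) *
          (Real.exp (2 * κ * |t|) - 1) := by gcongr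
      _ = _ := by ring
  constructor
  · rintro ⟨hA, hB, hAB⟩
    have := key (-1) (by simp) hA hB (by simpa [sub_eq_add_neg] using hAB hdisj)
    simpa [sub_eq_add_neg] using this
  · rintro ⟨hA, hB, hAB⟩
    have := key 1 (by simp) hA hB (by simpa using hAB hdisj)
    simpa using this

/-- A submultiplicative decay function is reproduced by an interaction whose strength is summable
against its inverse at the diameter of the supports. -/
theorem groupVelocityBound_of_sum {g : ℕ → ℝ} (hg : ∀ r, 0 < g r) (hanti : Antitone g)
    (hmul : ∀ r s, g r * g s ≤ g (r + s)) {s₁ : ℝ}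
    (h : ∀ n, ∀ x ∈ L.Λ n, ∑ X ∈ (L.Λ n).powerset with x ∈ X,
      ‖L.h n X‖ * (X.card : ℝ) * (g (setDiam (L.bonds n) X))⁻¹ ≤ s₁) :
    ∃ v, 0 < v ∧ L.GroupVelocityBound g v := by
  have hs : s₁ ≤ max s₁ 1 := le_max_left _ _
  refine ⟨2 * max s₁ 1, by positivity, L.groupVelocityBound_of_decay (fun r => (hg r).le) hanti
    (by positivity) ?_ ?_⟩
  · intro n z hz y hy
    calc L.pairStrength n z y = ∑ X ∈ (L.Λ n).powerset with z ∈ X,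
          if y ∈ X then ‖L.h n X‖ else 0 := by
          rw [pairStrength, ← Finset.filter_filter, Finset.sum_filter]
      _ ≤ ∑ X ∈ (L.Λ n).powerset with z ∈ X,
          (‖L.h n X‖ * (X.card : ℝ) * (g (setDiam (L.bonds n) X))⁻¹) *
            g ((L.bonds n).dist z y) := by
          refine Finset.sum_le_sum fun X hX => ?_
          have hzX := (Finset.mem_filter.1 hX).2
          have h0 := hg (setDiam (L.bonds n) X)
          have h0' := hg ((L.bonds n).dist z y)
          split_ifs with hyX
          · have h1 : g (setDiam (L.bonds n) X) ≤ g ((L.bonds n).dist z y) :=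
              hanti (dist_le_setDiam _ hzX hyX)
            have h2 : (1 : ℝ) ≤ X.card := by
              exact_mod_cast Finset.card_pos.2 ⟨z, hzX⟩
            have h3 : 1 ≤ (g (setDiam (L.bonds n) X))⁻¹ * g ((L.bonds n).dist z y) := by
              rw [inv_mul_eq_div, one_le_div h0]
              exact h1
            calc ‖L.h n X‖ = ‖L.h n X‖ * 1 * 1 := by ring
              _ ≤ ‖L.h n X‖ * (X.card : ℝ) *
                  ((g (setDiam (L.bonds n) X))⁻¹ * g ((L.bonds n).dist z y)) := by gcongr
              _ = _ := by ring
          · positivity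
      _ ≤ _ := by
          rw [← Finset.sum_mul]
          exact mul_le_mul_of_nonneg_right ((h n z hz).trans hs) (hg _).le
  · intro n z hz y hy
    rw [← sum_norm_mul_sum L n z (fun z' => g ((L.bonds n).dist z' y))]
    calc _ ≤ ∑ X ∈ (L.Λ n).powerset with z ∈ X,
          (‖L.h n X‖ * (X.card : ℝ) * (g (setDiam (L.bonds n) X))⁻¹) *
            g ((L.bonds n).dist z y) := by
          refine Finset.sum_le_sum fun X hX => ?_
          have hzX := (Finset.mem_filter.1 hX).2
          have hXΛ : X ⊆ L.Λ n := Finset.mem_powerset.1 (Finset.mem_filter.1 hX).1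
          have h0 := hg (setDiam (L.bonds n) X)
          have h1 : ∀ z' ∈ X, g ((L.bonds n).dist z' y) ≤
              (g (setDiam (L.bonds n) X))⁻¹ * g ((L.bonds n).dist z y) := by
            intro z' hz'
            rw [inv_mul_eq_div, le_div_iff₀ h0, mul_comm]
            refine (hmul _ _).trans (hanti ?_)
            exact (L.dist_triangle n hz (hXΛ hz') hy).trans
              (Nat.add_le_add_right (dist_le_setDiam _ hzX hz') _)
          have h2 := Finset.sum_le_card_nsmul _ _ _ h1
          rw [nsmul_eq_mul] at h2
          refine (mul_le_mul_of_nonneg_left h2 (norm_nonneg _)).trans (le_of_eq (by ring))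
      _ ≤ _ := by
          rw [← Finset.sum_mul]
          exact mul_le_mul_of_nonneg_right ((h n z hz).trans hs) (hg _).le

theorem antitone_powerDecay {η : ℝ} (hη : 0 ≤ η) :
    Antitone fun r : ℕ => (1 + (r : ℝ)) ^ (-η) := by
  intro r s hrs
  exact Real.rpow_le_rpow_of_nonpos (by positivity) (by gcongr) (by linarith)

theorem antitone_expDecay {μ : ℝ} (hμ : 0 ≤ μ) :
    Antitone fun r : ℕ => Real.exp (-(μ * (r : ℝ))) := by
  intro r s hrs
  simp only
  gcongr

/-- Power-law decaying interactions have a finite group velocity. -/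
theorem exists_groupVelocityBound_power {η : ℝ} (h : L.PowerLaw η) :
    ∃ v, 0 < v ∧ L.GroupVelocityBound (fun r => (1 + (r : ℝ)) ^ (-η)) v := by
  obtain ⟨hη, ⟨lam₀, p₀, hlam, hp, h⟩ | ⟨s₁, h⟩⟩ := h
  · have hF : ∀ r : ℕ, 1 / (1 + (r : ℝ)) ^ η = (1 + (r : ℝ)) ^ (-η) := fun r => by
      rw [Real.rpow_neg (by positivity), one_div]
    refine ⟨2 * (lam₀ + lam₀ * p₀), by positivity, L.groupVelocityBound_of_decay
      (fun r => by positivity) (antitone_powerDecay hη.le) (by positivity) ?_ ?_⟩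
    · intro n z hz y hy
      have h1 := (h n z hz y hy).1
      rw [div_eq_mul_one_div, hF] at h1
      refine h1.trans ?_
      gcongr
      have : 0 < lam₀ * p₀ := by positivity
      linarith
    · intro n z hz y hy
      have h2 := (h n z hz y hy).2
      simp only [hF] at h2
      rw [div_eq_mul_one_div, hF] at h2
      calc _ ≤ ∑ z' ∈ L.Λ n, lam₀ * ((1 + ((L.bonds n).dist z z' : ℝ)) ^ (-η) *
              (1 + ((L.bonds n).dist z' y : ℝ)) ^ (-η)) := by
            refine Finset.sum_le_sum fun z' hz' => ?_
            have h1 := (h n z hz z' hz').1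
            rw [div_eq_mul_one_div, hF] at h1
            rw [← mul_assoc]
            gcongr
        _ ≤ lam₀ * (p₀ * (1 + ((L.bonds n).dist z y : ℝ)) ^ (-η)) := by
            rw [← Finset.mul_sum]
            gcongr
        _ ≤ _ := by
            rw [← mul_assoc]
            gcongr
            linarith
  · refine L.groupVelocityBound_of_sum (fun r => by positivity) (antitone_powerDecay hη.le) ?_
      (s₁ := s₁) ?_
    · intro r s
      rw [← Real.mul_rpow (by positivity) (by positivity)]
      refine Real.rpow_le_rpow_of_nonpos (by positivity) ?_ (by linarith)
      push_cast
      nlinarith [mul_nonneg (Nat.cast_nonneg (α := ℝ) r) (Nat.cast_nonneg (α := ℝ) s)]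
    · intro n x hx
      refine (le_of_eq ?_).trans (h n x hx)
      refine Finset.sum_congr rfl fun X _ => ?_
      rw [Real.rpow_neg (by positivity), inv_inv]

theorem exp_neg_le_mul_powerDecay {ε η : ℝ} (hε : 0 < ε) (hη : 0 < η) (r : ℝ) (hr : 0 ≤ r) :
    Real.exp (-(ε * r)) ≤ ((η / ε) ^ η * Real.exp ε) * (1 / (1 + r) ^ η) := by
  have h1 : (ε / η * (1 + r)) ^ η ≤ Real.exp (ε * (1 + r)) := by
    have h2 : ε / η * (1 + r) ≤ Real.exp (ε / η * (1 + r)) :=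
      (by linarith [Real.add_one_le_exp (ε / η * (1 + r))])
    calc _ ≤ Real.exp (ε / η * (1 + r)) ^ η := by gcongr
      _ = _ := by
        rw [← Real.exp_mul]
        congr 1
        field_simp
  have h3 : (ε / η) ^ η * (η / ε) ^ η = 1 := by
    rw [← Real.mul_rpow (by positivity) (by positivity)]
    have : ε / η * (η / ε) = 1 := by field_simp
    rw [this, Real.one_rpow]
  rw [Real.mul_rpow (by positivity) (by positivity), mul_add, mul_one, Real.exp_add] at h1
  have h4 : (1 + r) ^ η ≤ (η / ε) ^ η * (Real.exp ε * Real.exp (ε * r)) := by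
    calc (1 + r) ^ η = (η / ε) ^ η * ((ε / η) ^ η * (1 + r) ^ η) := by
          rw [← mul_assoc, mul_comm ((η / ε) ^ η), h3, one_mul]
      _ ≤ _ := by gcongr
  have h5 : 0 < (1 + r) ^ η := by positivity
  rw [Real.exp_neg, mul_one_div, inv_eq_one_div, div_le_div_iff₀ (Real.exp_pos _) h5]
  linarith

/-- Exponentially decaying interactions have a finite group velocity. -/
theorem exists_groupVelocityBound_exp {μ : ℝ} (h : L.Exponential μ) :
    ∃ v, 0 < v ∧ L.GroupVelocityBound (fun r => Real.exp (-(μ * (r : ℝ)))) v := by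
  obtain ⟨hμ, ⟨⟨η, K, hη, hK⟩, lam₀, ε, hlam, hε, h⟩ | ⟨s₁, h⟩⟩ := h
  · set c := (η / ε) ^ η * Real.exp ε with hc
    have hc0 : 0 < c := by positivity
    have hsplit : ∀ r : ℕ, Real.exp (-(μ + ε) * (r : ℝ))
        = Real.exp (-(μ * (r : ℝ))) * Real.exp (-(ε * r)) := fun r => by
      rw [← Real.exp_add]
      congr 1
      ring
    have hK' : c * K ≤ c * max K 0 := by
      gcongr
      exact le_max_left _ _
    refine ⟨2 * (lam₀ + lam₀ * (c * max K 0)), by positivity, L.groupVelocityBound_of_decay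
      (fun r => by positivity) (antitone_expDecay hμ.le) (by positivity) ?_ ?_⟩
    · intro n z hz y hy
      refine (h n z hz y hy).trans ?_
      rw [hsplit]
      calc _ ≤ lam₀ * (Real.exp (-(μ * ((L.bonds n).dist z y : ℝ))) * 1) := by
            gcongr
            exact Real.exp_le_one_iff.2 (by simp; positivity)
        _ ≤ _ := by
            rw [mul_one]
            gcongr
            have : 0 ≤ lam₀ * (c * max K 0) := by positivity
            linarith
    · intro n z hz y hy
      calc _ ≤ ∑ z' ∈ L.Λ n, lam₀ * Real.exp (-(μ * ((L.bonds n).dist z y : ℝ))) *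
              (c * (1 / (1 + ((L.bonds n).dist z z' : ℝ)) ^ η)) := by
            refine Finset.sum_le_sum fun z' hz' => ?_
            have h1 := h n z hz z' hz'
            have h2 := exp_neg_le_mul_powerDecay hε hη ((L.bonds n).dist z z') (by positivity)
            have h3 : Real.exp (-(μ * ((L.bonds n).dist z z' : ℝ))) *
                Real.exp (-(μ * ((L.bonds n).dist z' y : ℝ)))
                ≤ Real.exp (-(μ * ((L.bonds n).dist z y : ℝ))) := by
              rw [← Real.exp_add]
              gcongr
              have : ((L.bonds n).dist z y : ℝ) ≤ (L.bonds n).dist z z' + (L.bonds n).dist z' y := by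
                exact_mod_cast L.dist_triangle n hz hz' hy
              nlinarith
            rw [hsplit] at h1
            calc _ ≤ lam₀ * (Real.exp (-(μ * ((L.bonds n).dist z z' : ℝ))) *
                  Real.exp (-(ε * ((L.bonds n).dist z z' : ℝ)))) *
                  Real.exp (-(μ * ((L.bonds n).dist z' y : ℝ))) := by gcongr
              _ = lam₀ * (Real.exp (-(μ * ((L.bonds n).dist z z' : ℝ))) *
                  Real.exp (-(μ * ((L.bonds n).dist z' y : ℝ)))) *
                  Real.exp (-(ε * ((L.bonds n).dist z z' : ℝ))) := by ring
              _ ≤ _ := by gcongr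
        _ ≤ lam₀ * Real.exp (-(μ * ((L.bonds n).dist z y : ℝ))) * (c * max K 0) := by
            rw [← Finset.mul_sum, ← Finset.mul_sum]
            gcongr
            exact (hK n z hz).trans (le_max_left _ _)
        _ ≤ _ := by
            rw [mul_right_comm]
            gcongr
            linarith
  · refine L.groupVelocityBound_of_sum (fun r => by positivity) (antitone_expDecay hμ.le) ?_
      (s₁ := s₁) ?_
    · intro r s
      rw [← Real.exp_add]
      push_cast
      gcongr
      linarith
    · intro n x hx
      refine (le_of_eq ?_).trans (h n x hx)
      refine Finset.sum_congr rfl fun X _ => ?_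
      rw [Real.exp_neg, inv_inv]

end LatticeSystem

section GaussianFilter

open MeasureTheory Set

/-- `∫₀^∞ exp(-αt²) sin(ωt)/t dt`: a smooth approximation of `(π/2) sgn ω`. -/
noncomputable def gaussSine (α ω : ℝ) : ℝ :=
  ∫ t in Ioi (0 : ℝ), Real.exp (-α * t ^ 2) * (Real.sin (ω * t) / t)

theorem abs_sin_mul_div_le (ω t : ℝ) : |Real.sin (ω * t) / t| ≤ |ω| := by
  rw [abs_div]
  refine div_le_of_le_mul₀ (abs_nonneg _) (abs_nonneg _) ?_
  rw [← abs_mul]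
  exact Real.abs_sin_le_abs

theorem integrable_gaussSine {α : ℝ} (hα : 0 < α) (ω : ℝ) :
    Integrable (fun t => Real.exp (-α * t ^ 2) * (Real.sin (ω * t) / t)) := by
  refine ((integrable_exp_neg_mul_sq hα).mul_const |ω|).mono' ?_ ?_
  · exact (by fun_prop : Measurable fun t => Real.exp (-α * t ^ 2) *
      (Real.sin (ω * t) / t)).aestronglyMeasurable
  · refine Eventually.of_forall fun t => ?_
    rw [norm_mul, Real.norm_of_nonneg (Real.exp_pos _).le]
    exact mul_le_mul_of_nonneg_left (abs_sin_mul_div_le ω t) (Real.exp_pos _).le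

theorem abs_gaussSine_le {α : ℝ} (hα : 0 < α) (ω : ℝ) :
    |gaussSine α ω| ≤ √(Real.pi / α) / 2 * |ω| := by
  rw [← integral_gaussian_Ioi, ← integral_mul_const]
  rw [← Real.norm_eq_abs, gaussSine]
  refine norm_integral_le_of_norm_le
    ((integrable_exp_neg_mul_sq hα).mul_const |ω|).integrableOn (Eventually.of_forall fun t => ?_)
  rw [norm_mul, Real.norm_of_nonneg (Real.exp_pos _).le]
  exact mul_le_mul_of_nonneg_left (abs_sin_mul_div_le ω t) (Real.exp_pos _).le

/-- The cosine transform of a Gaussian. -/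
theorem integral_Ioi_gaussian_mul_cos {α : ℝ} (hα : 0 < α) (ω : ℝ) :
    ∫ t in Ioi (0 : ℝ), Real.exp (-α * t ^ 2) * Real.cos (ω * t) =
      √(Real.pi / α) / 2 * Real.exp (-(1 / (4 * α)) * ω ^ 2) := by
  have h1 := fourierIntegral_gaussian (b := (α : ℂ)) (by simpa using hα) (ω : ℂ)
  have h2 : ∫ t : ℝ, Real.exp (-α * t ^ 2) * Real.cos (ω * t) =
      (∫ t : ℝ, Complex.exp (Complex.I * ω * t) * Complex.exp (-α * t ^ 2)).re := by
    have hint : Integrable fun t : ℝ =>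
        Complex.exp (Complex.I * ω * t) * Complex.exp (-α * t ^ 2) := by
      refine (integrable_exp_neg_mul_sq hα).mono' ?_ (Eventually.of_forall fun t => ?_)
      · exact (by fun_prop : Continuous fun t : ℝ => Complex.exp (Complex.I * ω * t) *
          Complex.exp (-α * t ^ 2)).aestronglyMeasurable
      · have e1 : Complex.I * ω * t = ((ω * t : ℝ) : ℂ) * Complex.I := by push_cast; ring
        have e2 : (-α * t ^ 2 : ℂ) = ((-α * t ^ 2 : ℝ) : ℂ) := by push_cast; ring
        rw [norm_mul, e1, Complex.norm_exp_ofReal_mul_I, one_mul, e2, Complex.norm_exp_ofReal]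
    have h3 := integral_re hint
    simp only [RCLike.re_to_complex] at h3
    rw [← h3]
    refine integral_congr_ae (Eventually.of_forall fun t => ?_)
    have e1 : Complex.I * ω * t = ((ω * t : ℝ) : ℂ) * Complex.I := by push_cast; ring
    have e2 : (-α * t ^ 2 : ℂ) = ((-α * t ^ 2 : ℝ) : ℂ) := by push_cast; ring
    simp only
    rw [e1, e2, ← Complex.ofReal_exp, Complex.re_mul_ofReal, Complex.exp_ofReal_mul_I_re, mul_comm]
  have h4 : ∫ t : ℝ, Real.exp (-α * t ^ 2) * Real.cos (ω * t) =
      2 * ∫ t in Ioi (0 : ℝ), Real.exp (-α * t ^ 2) * Real.cos (ω * t) := by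
    rw [← integral_comp_abs]
    refine integral_congr_ae (Eventually.of_forall fun t => ?_)
    rcases abs_choice t with h | h <;> simp [h]
  have h5 : ((Real.pi / α : ℂ) ^ (1 / 2 : ℂ) * Complex.exp (-(ω : ℂ) ^ 2 / (4 * α))) =
      ((√(Real.pi / α) * Real.exp (-(1 / (4 * α)) * ω ^ 2) : ℝ) : ℂ) := by
    have e1 : (-(ω : ℂ) ^ 2 / (4 * α)) = ((-(1 / (4 * α)) * ω ^ 2 : ℝ) : ℂ) := by
      push_cast; ring
    have e2 : (Real.pi / α : ℂ) ^ (1 / 2 : ℂ) = ((√(Real.pi / α) : ℝ) : ℂ) := by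
      rw [Real.sqrt_eq_rpow, Complex.ofReal_cpow (by positivity)]
      push_cast
      rfl
    rw [e1, e2, ← Complex.ofReal_exp, ← Complex.ofReal_mul]
  rw [h4, h1, h5, Complex.ofReal_re] at h2
  linarith

theorem hasDerivAt_gaussSine {α : ℝ} (hα : 0 < α) (ω : ℝ) :
    HasDerivAt (gaussSine α) (√(Real.pi / α) / 2 * Real.exp (-(1 / (4 * α)) * ω ^ 2)) ω := by
  rw [← integral_Ioi_gaussian_mul_cos hα]
  change HasDerivAt (fun ω => ∫ t in Ioi (0 : ℝ), Real.exp (-α * t ^ 2) * (Real.sin (ω * t) / t))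
    _ ω
  refine (hasDerivAt_integral_of_dominated_loc_of_deriv_le (s := univ) univ_mem
    (μ := volume.restrict (Ioi 0)) (F' := fun ω t => Real.exp (-α * t ^ 2) * Real.cos (ω * t))
    (F := fun ω t => Real.exp (-α * t ^ 2) * (Real.sin (ω * t) / t))
    (bound := fun t => Real.exp (-α * t ^ 2))
    (Eventually.of_forall fun x => (integrable_gaussSine hα x).integrableOn.aestronglyMeasurable)
    (integrable_gaussSine hα ω).integrableOn ?_ ?_
    (integrable_exp_neg_mul_sq hα).integrableOn ?_).2
  · exact (by fun_prop : Continuous fun t => Real.exp (-α * t ^ 2) *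
      Real.cos (ω * t)).aestronglyMeasurable
  · refine Eventually.of_forall fun t x _ => ?_
    rw [norm_mul, Real.norm_of_nonneg (Real.exp_pos _).le]
    exact mul_le_of_le_one_right (Real.exp_pos _).le (Real.abs_cos_le_one _)
  · refine (ae_restrict_mem measurableSet_Ioi).mono fun t (ht : 0 < t) x _ => ?_
    have h := ((((hasDerivAt_id x).mul_const t).sin).div_const t).const_mul (Real.exp (-α * t ^ 2))
    refine h.congr_deriv ?_
    simp only [id]
    field_simp

theorem setIntegral_Ioi_comp_add (f : ℝ → ℝ) (w : ℝ) :
    ∫ u in Ioi w, f u = ∫ u in Ioi (0 : ℝ), f (u + w) := by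
  have h := (measurePreserving_add_right volume w).setIntegral_preimage_emb
    (MeasurableEquiv.addRight w).measurableEmbedding f (Ioi w)
  rw [← h]
  simp

/-- Above the gap, `gaussSine` is exponentially close to `π/2`. -/
theorem abs_gaussSine_sub_le {α : ℝ} (hα : 0 < α) {ω : ℝ} (hω : 0 ≤ ω) :
    |gaussSine α ω - Real.pi / 2| ≤ Real.pi / 2 * Real.exp (-(1 / (4 * α)) * ω ^ 2) := by
  have hb : 0 < 1 / (4 * α) := by positivity
  set c := √(Real.pi / α) / 2 with hc
  have hc0 : 0 ≤ c := by positivity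
  have hint := integrable_exp_neg_mul_sq hb
  have h1 : gaussSine α ω = ∫ x in (0 : ℝ)..ω, c * Real.exp (-(1 / (4 * α)) * x ^ 2) := by
    rw [intervalIntegral.integral_eq_sub_of_hasDerivAt
      (fun x _ => hasDerivAt_gaussSine hα x) (hint.const_mul c).intervalIntegrable]
    simp [gaussSine]
  have h2 := intervalIntegral.integral_Ioi_sub_Ioi (hint.const_mul c).integrableOn hω
  have hprod : c * (√(Real.pi / (1 / (4 * α))) / 2) = Real.pi / 2 := by
    have : √(Real.pi / α) * √(Real.pi / (1 / (4 * α))) = 2 * Real.pi := by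
      rw [← Real.sqrt_mul (by positivity)]
      have : Real.pi / α * (Real.pi / (1 / (4 * α))) = (2 * Real.pi) ^ 2 := by
        field_simp
        ring
      rw [this, Real.sqrt_sq (by positivity)]
    rw [hc]
    linarith
  have h3 : ∫ x in Ioi (0 : ℝ), c * Real.exp (-(1 / (4 * α)) * x ^ 2) = Real.pi / 2 := by
    rw [integral_const_mul, integral_gaussian_Ioi, hprod]
  have h4 : ∫ x in Ioi ω, c * Real.exp (-(1 / (4 * α)) * x ^ 2) ≤
      Real.pi / 2 * Real.exp (-(1 / (4 * α)) * ω ^ 2) := by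
    rw [← h3, setIntegral_Ioi_comp_add, ← integral_mul_const]
    refine integral_mono_of_nonneg (Eventually.of_forall fun x => by positivity)
      ((hint.const_mul c).mul_const _).integrableOn ?_
    refine (ae_restrict_mem measurableSet_Ioi).mono fun x (hx : 0 < x) => ?_
    simp only
    rw [mul_assoc, ← Real.exp_add]
    gcongr
    nlinarith [mul_nonneg hb.le (mul_nonneg hx.le hω)]
  have h5 : 0 ≤ ∫ x in Ioi ω, c * Real.exp (-(1 / (4 * α)) * x ^ 2) :=
    integral_nonneg fun x => by positivity
  have h6 : gaussSine α ω - Real.pi / 2 =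
      -∫ x in Ioi ω, c * Real.exp (-(1 / (4 * α)) * x ^ 2) := by
    rw [h1, ← h2, h3]
    ring
  rw [h6, abs_neg, abs_of_nonneg h5]
  exact h4

theorem integral_Ioi_mul_gaussian {α : ℝ} (hα : 0 < α) (s : ℝ) (hs : 0 ≤ s) :
    IntegrableOn (fun t => t * Real.exp (-α * t ^ 2)) (Ioi s) ∧
      ∫ t in Ioi s, t * Real.exp (-α * t ^ 2) = Real.exp (-α * s ^ 2) / (2 * α) := by
  have hd : ∀ t ∈ Ici s, HasDerivAt (fun t => -(Real.exp (-α * t ^ 2) / (2 * α)))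
      (t * Real.exp (-α * t ^ 2)) t := by
    intro t _
    have h := ((((hasDerivAt_id t).pow 2).const_mul (-α)).exp.div_const (2 * α)).neg
    refine h.congr_deriv ?_
    simp only [id]
    field_simp
    simp
    ring
  have hpos : ∀ t ∈ Ioi s, 0 ≤ t * Real.exp (-α * t ^ 2) := fun t ht =>
    mul_nonneg (hs.trans (le_of_lt ht)) (Real.exp_pos _).le
  have hlim : Tendsto (fun t => -(Real.exp (-α * t ^ 2) / (2 * α))) atTop (𝓝 0) := by
    have h1 : Tendsto (fun t : ℝ => -α * t ^ 2) atTop atBot :=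
      (tendsto_pow_atTop two_ne_zero).const_mul_atTop_of_neg (neg_lt_zero.2 hα)
    have h2 := ((Real.tendsto_exp_atBot.comp h1).div_const (2 * α)).neg
    simpa using h2
  refine ⟨integrableOn_Ioi_deriv_of_nonneg' hd hpos hlim, ?_⟩
  rw [integral_Ioi_of_hasDerivAt_of_nonneg' hd hpos hlim]
  ring

/-- The filtered sum of frequencies is controlled by the short-time growth of the signal
`∑ c_k sin(ω_k t)` and the Gaussian tail. -/
theorem norm_sum_mul_gaussSine_le {ι : Type*} [Fintype ι] (c : ι → ℂ) (ω : ι → ℝ)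
    {α s v N₁ N₂ N₃ : ℝ} (hα : 0 < α) (hs : 0 < s) (hN₁ : 0 ≤ N₁)
    (h1 : ∀ t, 0 < t → ‖∑ k, c k * (Real.sin (ω k * t) : ℂ)‖ ≤
      N₁ * (Real.exp (v * t) - 1) + N₃ * t)
    (h2 : ∀ t, ‖∑ k, c k * (Real.sin (ω k * t) : ℂ)‖ ≤ N₂) :
    ‖∑ k, c k * (gaussSine α (ω k) : ℂ)‖ ≤
      N₁ * Real.exp (v * s) + N₃ * s + N₂ * (Real.exp (-α * s ^ 2) / (2 * α * s ^ 2)) := by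
  let f : ℝ → ℂ := fun t => ∑ k, c k * ((Real.exp (-α * t ^ 2) * (Real.sin (ω k * t) / t) : ℝ) : ℂ)
  have hfi : Integrable f := integrable_finsetSum _ fun k _ =>
    (integrable_gaussSine hα (ω k)).ofReal.const_mul (c k)
  have hsum : ∑ k, c k * (gaussSine α (ω k) : ℂ) = ∫ t in Ioi (0 : ℝ), f t := by
    have h := integral_finsetSum (μ := volume.restrict (Ioi 0)) Finset.univ (f := fun k t =>
      c k * ((Real.exp (-α * t ^ 2) * (Real.sin (ω k * t) / t) : ℝ) : ℂ)) fun k _ =>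
      ((integrable_gaussSine hα (ω k)).ofReal.const_mul (c k)).integrableOn
    refine Eq.trans ?_ h.symm
    refine Finset.sum_congr rfl fun k _ => ?_
    rw [integral_const_mul, integral_complex_ofReal]
    rfl
  have hf : ∀ t, 0 < t → ‖f t‖ =
      Real.exp (-α * t ^ 2) * (‖∑ k, c k * (Real.sin (ω k * t) : ℂ)‖ / t) := by
    intro t ht
    have : f t = (Real.exp (-α * t ^ 2) : ℂ) * ((∑ k, c k * (Real.sin (ω k * t) : ℂ)) / (t : ℂ)) := by
      simp only [f, Finset.sum_div, Finset.mul_sum]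
      refine Finset.sum_congr rfl fun k _ => ?_
      push_cast
      ring
    rw [this, norm_mul, norm_div, Complex.norm_real, Complex.norm_real,
      Real.norm_of_nonneg (Real.exp_pos _).le, Real.norm_of_nonneg ht.le]
  have hexp1 : ∀ t, 0 < t → Real.exp (-α * t ^ 2) ≤ 1 := fun t _ =>
    Real.exp_le_one_iff.2 (by nlinarith [sq_nonneg t])
  have hsplit : ∫ t in Ioi (0 : ℝ), f t = (∫ t in (0 : ℝ)..s, f t) + ∫ t in Ioi s, f t := by
    rw [← intervalIntegral.integral_Ioi_sub_Ioi hfi.integrableOn hs.le]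
    ring
  have hA : ‖∫ t in (0 : ℝ)..s, f t‖ ≤ N₁ * Real.exp (v * s) + N₃ * s := by
    have hd : ∀ t ∈ uIcc 0 s, HasDerivAt (fun t => N₁ * Real.exp (v * t) + N₃ * t)
        (N₁ * (Real.exp (v * t) * v) + N₃) t := by
      intro t _
      have := (((hasDerivAt_id t).const_mul v).exp.const_mul N₁).add
        ((hasDerivAt_id t).const_mul N₃)
      refine this.congr_deriv ?_
      simp
    have hcont : Continuous fun t => N₁ * (Real.exp (v * t) * v) + N₃ := by fun_prop
    have hb : ‖∫ t in (0 : ℝ)..s, f t‖ ≤ ∫ t in (0 : ℝ)..s, (N₁ * (Real.exp (v * t) * v) + N₃) := by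
      refine intervalIntegral.norm_integral_le_of_norm_le hs.le ?_ (hcont.intervalIntegrable _ _)
      refine Eventually.of_forall fun t ht => ?_
      rw [hf t ht.1]
      have e1 : Real.exp (v * t) - 1 ≤ Real.exp (v * t) * (v * t) := by
        have := Real.add_one_le_exp (-(v * t))
        have h3 : Real.exp (v * t) * Real.exp (-(v * t)) = 1 := by
          rw [← Real.exp_add]
          simp
        nlinarith [Real.exp_pos (v * t)]
      have e2 : ‖∑ k, c k * (Real.sin (ω k * t) : ℂ)‖ / t ≤ N₁ * (Real.exp (v * t) * v) + N₃ := by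
        rw [div_le_iff₀ ht.1]
        refine (h1 t ht.1).trans ?_
        have := mul_le_mul_of_nonneg_left e1 hN₁
        linarith
      have e3 : 0 ≤ ‖∑ k, c k * (Real.sin (ω k * t) : ℂ)‖ / t := div_nonneg (norm_nonneg _) ht.1.le
      exact (mul_le_of_le_one_left e3 (hexp1 t ht.1)).trans e2
    rw [intervalIntegral.integral_eq_sub_of_hasDerivAt hd (hcont.intervalIntegrable _ _)] at hb
    simp only [mul_zero, Real.exp_zero, mul_one, add_zero] at hb
    linarith
  have hB : ‖∫ t in Ioi s, f t‖ ≤ N₂ * (Real.exp (-α * s ^ 2) / (2 * α * s ^ 2)) := by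
    obtain ⟨i1, i2⟩ := integral_Ioi_mul_gaussian hα s hs.le
    have hN₂ : 0 ≤ N₂ := (norm_nonneg _).trans (h2 0)
    have e : N₂ * (Real.exp (-α * s ^ 2) / (2 * α * s ^ 2)) =
        ∫ t in Ioi s, N₂ / s ^ 2 * (t * Real.exp (-α * t ^ 2)) := by
      rw [integral_const_mul, i2]
      field_simp
    rw [e]
    refine norm_integral_le_of_norm_le (i1.const_mul _)
      ((ae_restrict_mem measurableSet_Ioi).mono fun t (ht : s < t) => ?_)
    have ht0 : 0 < t := hs.trans ht
    rw [hf t ht0]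
    have e2 : ‖∑ k, c k * (Real.sin (ω k * t) : ℂ)‖ / t ≤ N₂ / s ^ 2 * t := by
      rw [div_le_iff₀ ht0]
      refine (h2 t).trans ?_
      rw [div_mul_eq_mul_div, div_mul_eq_mul_div, le_div_iff₀ (by positivity)]
      nlinarith [mul_le_mul_of_nonneg_left (pow_le_pow_left₀ hs.le ht.le 2) hN₂]
    calc _ ≤ Real.exp (-α * t ^ 2) * (N₂ / s ^ 2 * t) :=
          mul_le_mul_of_nonneg_left e2 (Real.exp_pos _).le
      _ = _ := by ring
  rw [hsum, hsplit]
  exact (norm_add_le _ _).trans (add_le_add hA hB)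

end GaussianFilter

section Spectral

variable {E : Type*} [NormedAddCommGroup E] [InnerProductSpace ℂ E] [CompleteSpace E]

/-- A self-adjoint operator is diagonal in an orthonormal basis of an invariant finite-dimensional
subspace. -/
theorem exists_eigenbasis {H : E →L[ℂ] E} (hH : IsSelfAdjoint H) (W : Submodule ℂ E)
    [FiniteDimensional ℂ W] (hW : ∀ ψ ∈ W, H ψ ∈ W) :
    ∃ (m : ℕ) (e : Fin m → E) (ev : Fin m → ℝ), Orthonormal ℂ e ∧ (∀ k, e k ∈ W) ∧
      (∀ k, H (e k) = (ev k : ℂ) • e k) ∧ ∀ ψ ∈ W, ∑ k, ⟪e k, ψ⟫_ℂ • e k = ψ := by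
  have hsymm : (H : E →ₗ[ℂ] E).IsSymmetric := hH.isSymmetric
  have hT := hsymm.restrict_invariant hW
  let b := hT.eigenvectorBasis rfl
  refine ⟨_, fun k => b k, hT.eigenvalues rfl, ?_, fun k => (b k).2, fun k => ?_, fun ψ hψ => ?_⟩
  · exact b.orthonormal.comp_linearIsometry W.subtypeₗᵢ
  · exact congrArg Subtype.val (hT.apply_eigenvectorBasis rfl k)
  · have := congrArg Subtype.val (b.sum_repr' ⟨ψ, hψ⟩)
    simpa using this

theorem propagator_apply_eigenvector {H : E →L[ℂ] E} {ψ : E} {a : ℝ} (h : H ψ = (a : ℂ) • ψ)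
    (t : ℝ) : propagator H t ψ = Complex.exp (((a * t : ℝ) : ℂ) * Complex.I) • ψ := by
  set z : ℂ := ((a * t : ℝ) : ℂ) * Complex.I with hz
  set T : E →L[ℂ] E := (Complex.I * (t : ℂ)) • H with hT
  have hTψ : ∀ n : ℕ, (T ^ n) ψ = z ^ n • ψ := by
    intro n
    induction n with
    | zero => simp
    | succ n ih =>
      have h1 : T ψ = z • ψ := by
        rw [hT, smul_apply, h, smul_smul, hz]
        congr 1
        push_cast
        ring
      rw [pow_succ, mul_apply_eq_comp, h1, map_smul, ih, smul_smul, pow_succ, mul_comm]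
  have s1 := (NormedSpace.exp_series_hasSum_exp' (𝕂 := ℂ) T).mapL
    (ContinuousLinearMap.apply ℂ E ψ)
  have s2 := (NormedSpace.exp_series_hasSum_exp' (𝕂 := ℂ) z).smul_const ψ
  rw [← Complex.exp_eq_exp_ℂ] at s2
  have hfun : (fun n : ℕ => ContinuousLinearMap.apply ℂ E ψ ((n.factorial : ℂ)⁻¹ • T ^ n)) =
      fun n : ℕ => ((n.factorial : ℂ)⁻¹ • z ^ n) • ψ := by
    funext n
    rw [ContinuousLinearMap.apply_apply, smul_apply, hTψ, smul_smul,
      smul_eq_mul]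
  rw [hfun] at s1
  exact s1.unique s2

theorem sum_norm_inner_mul_inner_le {ι : Type*} [Fintype ι] {e : ι → E} (he : Orthonormal ℂ e)
    (ξ ψ : E) : ∑ k, ‖⟪ξ, e k⟫_ℂ * ⟪e k, ψ⟫_ℂ‖ ≤ ‖ξ‖ * ‖ψ‖ := by
  have h1 := he.sum_inner_products_le ξ (s := Finset.univ)
  have h2 := he.sum_inner_products_le ψ (s := Finset.univ)
  have h3 := Finset.sum_mul_sq_le_sq_mul_sq Finset.univ (fun k => ‖⟪e k, ξ⟫_ℂ‖)
    (fun k => ‖⟪e k, ψ⟫_ℂ‖)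
  have h4 : ∑ k, ‖⟪ξ, e k⟫_ℂ * ⟪e k, ψ⟫_ℂ‖ = ∑ k, ‖⟪e k, ξ⟫_ℂ‖ * ‖⟪e k, ψ⟫_ℂ‖ := by
    refine Finset.sum_congr rfl fun k _ => ?_
    rw [norm_mul, norm_inner_symm]
  rw [h4]
  refine abs_le_of_sq_le_sq' ?_ (by positivity) |>.2
  rw [mul_pow]
  exact h3.trans (mul_le_mul h1 h2 (Finset.sum_nonneg fun _ _ => by positivity) (by positivity))

/-- The data of a Hamiltonian `H` diagonalized by the orthonormal family `e`, with the eigenvalues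
in `S` within `δ` of `e₀` and the other ones at least `ΔE` above `e₀`; `P` projects onto the span of
the former. -/
structure GappedBasis {ι : Type*} (H P : E →L[ℂ] E) (e : ι → E) (ev : ι → ℝ) (S : Finset ℝ)
    (e₀ δ ΔE : ℝ) : Prop where
  selfAdjoint : IsSelfAdjoint H
  orthonormal : Orthonormal ℂ e
  eigen : ∀ k, H (e k) = (ev k : ℂ) • e k
  proj_mem : ∀ k, ev k ∈ S → P (e k) = e k
  proj_notMem : ∀ k, ev k ∉ S → P (e k) = 0
  near : ∀ k, ev k ∈ S → |ev k - e₀| ≤ δ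
  gap : ∀ k, ev k ∉ S → e₀ + ΔE ≤ ev k

namespace GappedBasis

variable {ι : Type*} [Fintype ι] {H P : E →L[ℂ] E} {e : ι → E} {ev : ι → ℝ} {S : Finset ℝ}
  {e₀ δ ΔE : ℝ} (D : GappedBasis H P e ev S e₀ δ ΔE)
include D

/-- The evolution with the ground state energy subtracted. -/
theorem inner_phase_propagator (ξ : E) {ψ : E} (hψ : ∑ k, ⟪e k, ψ⟫_ℂ • e k = ψ) (t : ℝ) :
    ⟪ξ, Complex.exp (((-(e₀ * t) : ℝ) : ℂ) * Complex.I) • propagator H t ψ⟫_ℂ =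
      ∑ k, ⟪ξ, e k⟫_ℂ * ⟪e k, ψ⟫_ℂ * Complex.exp ((((ev k - e₀) * t : ℝ) : ℂ) * Complex.I) := by
  conv_lhs => rw [← hψ]
  rw [map_sum, Finset.smul_sum, inner_sum]
  refine Finset.sum_congr rfl fun k _ => ?_
  rw [map_smul, propagator_apply_eigenvector (D.eigen k), inner_smul_right, inner_smul_right,
    inner_smul_right]
  have : Complex.exp ((((ev k - e₀) * t : ℝ) : ℂ) * Complex.I) =
      Complex.exp (((-(e₀ * t) : ℝ) : ℂ) * Complex.I) *
        Complex.exp (((ev k * t : ℝ) : ℂ) * Complex.I) := by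
    rw [← Complex.exp_add]
    congr 1
    push_cast
    ring
  rw [this]
  ring

theorem inner_proj (ξ : E) {ψ : E} (hψ : ∑ k, ⟪e k, ψ⟫_ℂ • e k = ψ) :
    ⟪ξ, P ψ⟫_ℂ = ∑ k, ⟪ξ, e k⟫_ℂ * ⟪e k, ψ⟫_ℂ * (if ev k ∈ S then 1 else 0) := by
  conv_lhs => rw [← hψ]
  rw [map_sum, inner_sum]
  refine Finset.sum_congr rfl fun k _ => ?_
  rw [map_smul, inner_smul_right]
  split_ifs with h
  · rw [D.proj_mem k h]
    ring
  · rw [D.proj_notMem k h, inner_zero_right]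
    ring

/-- Vectors of the sector hardly move. -/
theorem norm_phase_propagator_sub_le {Φ : E} (hΦ : ∑ k, ⟪e k, Φ⟫_ℂ • e k = Φ)
    (hΦS : ∀ k, ev k ∉ S → ⟪e k, Φ⟫_ℂ = 0) (hδ : 0 ≤ δ) (t : ℝ) :
    ‖Complex.exp (((-(e₀ * t) : ℝ) : ℂ) * Complex.I) • propagator H t Φ - Φ‖ ≤ |t| * δ * ‖Φ‖ := by
  set y := Complex.exp (((-(e₀ * t) : ℝ) : ℂ) * Complex.I) • propagator H t Φ - Φ with hy
  have h1 : ⟪y, y⟫_ℂ = ∑ k, ⟪y, e k⟫_ℂ * ⟪e k, Φ⟫_ℂ *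
      (Complex.exp ((((ev k - e₀) * t : ℝ) : ℂ) * Complex.I) - 1) := by
    have h2 : ⟪y, Φ⟫_ℂ = ∑ k, ⟪y, e k⟫_ℂ * ⟪e k, Φ⟫_ℂ := by
      conv_lhs => rw [← hΦ, inner_sum]
      exact Finset.sum_congr rfl fun k _ => by rw [inner_smul_right, mul_comm]
    conv_lhs => rw [hy, inner_sub_right, ← hy, D.inner_phase_propagator y hΦ t, h2,
      ← Finset.sum_sub_distrib]
    exact Finset.sum_congr rfl fun k _ => by ring
  have h3 : ‖y‖ ^ 2 ≤ |t| * δ * (‖y‖ * ‖Φ‖) := by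
    have h4 : ‖⟪y, y⟫_ℂ‖ = ‖y‖ ^ 2 := by
      rw [inner_self_eq_norm_sq_to_K]
      simp
    rw [← h4, h1]
    calc _ ≤ ∑ k, |t| * δ * ‖⟪y, e k⟫_ℂ * ⟪e k, Φ⟫_ℂ‖ := by
          refine (norm_sum_le _ _).trans (Finset.sum_le_sum fun k _ => ?_)
          by_cases hk : ev k ∈ S
          · rw [norm_mul, mul_comm]
            gcongr
            rw [mul_comm _ Complex.I]
            refine Real.norm_exp_I_mul_ofReal_sub_one_le.trans ?_
            rw [Real.norm_eq_abs, abs_mul, mul_comm]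
            gcongr
            exact D.near k hk
          · simp [hΦS k hk]
      _ ≤ _ := by
          rw [← Finset.mul_sum]
          gcongr
          exact sum_norm_inner_mul_inner_le D.orthonormal y Φ
  rcases (norm_nonneg y).eq_or_lt with h0 | h0
  · rw [← h0]
    positivity
  · refine le_of_mul_le_mul_left ?_ h0
    linarith

/-- The finite-volume estimate behind clustering: `A` and `B` anticommute and the anticommutator
grows at most like `N (exp(v|t|) - 1)`. -/
theorem norm_correlation_le {A B : E →L[ℂ] E} {Φ : E}
    (hAΦ : ∑ k, ⟪e k, A Φ⟫_ℂ • e k = A Φ) (hBΦ : ∑ k, ⟪e k, B Φ⟫_ℂ • e k = B Φ)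
    (hΦ : ∑ k, ⟪e k, Φ⟫_ℂ • e k = Φ)
    (hΦS : ∀ k, ev k ∉ S → ⟪e k, Φ⟫_ℂ = 0) (hΦ1 : ‖Φ‖ = 1) (hδ : 0 ≤ δ) (hΔE : 0 < ΔE)
    (hAB : A * B + B * A = 0) {N v s : ℝ} (hN : 0 ≤ N) (hs : 0 < s)
    (hLR : ∀ t, ‖heisenberg H t A * B + B * heisenberg H t A‖ ≤ N * (Real.exp (v * |t|) - 1)) :
    Real.pi * ‖⟪Φ, (A * B) Φ⟫_ℂ - 1 / 2 * (⟪Φ, A (P (B Φ))⟫_ℂ - ⟪Φ, B (P (A Φ))⟫_ℂ)‖ ≤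
      N * Real.exp (v * s) + ‖A‖ * ‖B‖ * ((2 / (ΔE * s) + Real.pi) * Real.exp (-(ΔE * s / 2))) +
        ‖A‖ * ‖B‖ * (2 * s + √(Real.pi / (ΔE / (2 * s)))) * δ := by
  let U : ℝ → E →L[ℂ] E := fun t => Complex.exp (((-(e₀ * t) : ℝ) : ℂ) * Complex.I) • propagator H t
  have hUapp : ∀ t x, U t x = Complex.exp (((-(e₀ * t) : ℝ) : ℂ) * Complex.I) • propagator H t x :=
    fun _ _ => rfl
  have hUstar : ∀ t, star (U t) = U (-t) := by
    intro t
    simp only [U]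
    rw [star_smul, star_propagator D.selfAdjoint, Complex.star_def, ← Complex.exp_conj]
    simp
  have hUinner : ∀ t x y, ⟪x, U t y⟫_ℂ = ⟪U (-t) x, y⟫_ℂ := by
    intro t x y
    rw [← hUstar, ContinuousLinearMap.star_eq_adjoint, ContinuousLinearMap.adjoint_inner_left]
  have hphase : ∀ t : ℝ, Complex.exp (((-(e₀ * t) : ℝ) : ℂ) * Complex.I) *
      Complex.exp (((-(e₀ * -t) : ℝ) : ℂ) * Complex.I) = 1 := by
    intro t
    rw [← Complex.exp_add, ← Complex.exp_zero]
    congr 1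
    push_cast
    ring
  have hUU : ∀ t, U t * U (-t) = 1 := by
    intro t
    simp only [U]
    rw [smul_mul_smul_comm, hphase, propagator_mul_neg D.selfAdjoint, one_smul]
  have hUnorm : ∀ t x, ‖U t x‖ = ‖x‖ := by
    intro t x
    have h1 : ⟪U t x, U t x⟫_ℂ = ⟪x, x⟫_ℂ := by
      rw [hUinner, ← mul_apply_eq_comp]
      have := hUU (-t)
      rw [neg_neg] at this
      rw [this, one_apply_eq_self]
    rw [@norm_eq_sqrt_re_inner ℂ, h1, ← @norm_eq_sqrt_re_inner ℂ]
  have hheis : ∀ t, heisenberg H t A = U t * A * U (-t) := by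
    intro t
    simp only [U, heisenberg]
    rw [smul_mul_assoc, smul_mul_smul_comm, hphase, one_smul]
  have hadj : ∀ (T : E →L[ℂ] E) x, ⟪star T Φ, x⟫_ℂ = ⟪Φ, T x⟫_ℂ := by
    intro T x
    rw [ContinuousLinearMap.star_eq_adjoint, ContinuousLinearMap.adjoint_inner_left]
  have hnstar : ∀ T : E →L[ℂ] E, ‖star T Φ‖ ≤ ‖T‖ := by
    intro T
    have := (star T).le_opNorm Φ
    rwa [norm_star, hΦ1, mul_one] at this
  have hnapp : ∀ T : E →L[ℂ] E, ‖T Φ‖ ≤ ‖T‖ := by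
    intro T
    have := T.le_opNorm Φ
    rwa [hΦ1, mul_one] at this
  -- coefficients and frequencies
  let a : ι → ℂ := fun k => ⟪star A Φ, e k⟫_ℂ * ⟪e k, B Φ⟫_ℂ
  let b : ι → ℂ := fun k => ⟪star B Φ, e k⟫_ℂ * ⟪e k, A Φ⟫_ℂ
  let c : ι → ℂ := fun k => a k - b k
  let ω : ι → ℝ := fun k => ev k - e₀
  have hc : ∑ k, ‖c k‖ ≤ 2 * (‖A‖ * ‖B‖) := by
    have ha : ∑ k, ‖a k‖ ≤ ‖A‖ * ‖B‖ := (sum_norm_inner_mul_inner_le D.orthonormal _ _).trans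
      (mul_le_mul (hnstar A) (hnapp B) (norm_nonneg _) (norm_nonneg _))
    have hb : ∑ k, ‖b k‖ ≤ ‖B‖ * ‖A‖ := (sum_norm_inner_mul_inner_le D.orthonormal _ _).trans
      (mul_le_mul (hnstar B) (hnapp A) (norm_nonneg _) (norm_nonneg _))
    calc ∑ k, ‖c k‖ ≤ ∑ k, (‖a k‖ + ‖b k‖) := Finset.sum_le_sum fun k _ => norm_sub_le _ _
      _ ≤ _ := by
        rw [Finset.sum_add_distrib]
        linarith [mul_comm ‖A‖ ‖B‖]
  let G : ℝ → ℂ := fun t => ⟪star A Φ, U (-t) (B Φ)⟫_ℂ + ⟪star B Φ, U t (A Φ)⟫_ℂ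
  have hG : ∀ t, ‖G t‖ ≤ N * (Real.exp (v * |t|) - 1) + 2 * (|t| * δ * (‖A‖ * ‖B‖)) := by
    intro t
    have hmove : ‖U (-t) Φ - Φ‖ ≤ |t| * δ := by
      have := D.norm_phase_propagator_sub_le hΦ hΦS hδ (-t)
      rwa [hΦ1, mul_one, abs_neg] at this
    have hF : ⟪Φ, (heisenberg H t A * B + B * heisenberg H t A) Φ⟫_ℂ =
        ⟪U (-t) Φ, A (U (-t) (B Φ))⟫_ℂ + ⟪Φ, B (U t (A (U (-t) Φ)))⟫_ℂ := by
      rw [hheis, add_apply, inner_add_right]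
      congr 1
      exact hUinner t Φ _
    have hFG : G t = ⟪Φ, (heisenberg H t A * B + B * heisenberg H t A) Φ⟫_ℂ
        - (⟪U (-t) Φ - Φ, A (U (-t) (B Φ))⟫_ℂ + ⟪star B Φ, U t (A (U (-t) Φ - Φ))⟫_ℂ) := by
      rw [hF]
      simp only [G, hadj, inner_sub_left, map_sub, inner_sub_right]
      ring
    have e1 : ‖⟪Φ, (heisenberg H t A * B + B * heisenberg H t A) Φ⟫_ℂ‖ ≤
        N * (Real.exp (v * |t|) - 1) := by
      refine (norm_inner_le_norm _ _).trans ?_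
      rw [hΦ1, one_mul]
      exact (hnapp _).trans (hLR t)
    have e2 : ‖⟪U (-t) Φ - Φ, A (U (-t) (B Φ))⟫_ℂ‖ ≤ |t| * δ * (‖A‖ * ‖B‖) := by
      refine (norm_inner_le_norm _ _).trans (mul_le_mul hmove ?_ (norm_nonneg _) (by positivity))
      refine (A.le_opNorm _).trans ?_
      rw [hUnorm]
      exact mul_le_mul_of_nonneg_left (hnapp B) (norm_nonneg _)
    have e3 : ‖⟪star B Φ, U t (A (U (-t) Φ - Φ))⟫_ℂ‖ ≤ |t| * δ * (‖A‖ * ‖B‖) := by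
      refine (norm_inner_le_norm _ _).trans ?_
      rw [hUnorm]
      calc _ ≤ ‖B‖ * (‖A‖ * (|t| * δ)) := mul_le_mul (hnstar B)
            ((A.le_opNorm _).trans (mul_le_mul_of_nonneg_left hmove (norm_nonneg _)))
            (norm_nonneg _) (norm_nonneg _)
        _ = _ := by ring
    rw [hFG]
    refine (norm_sub_le _ _).trans ?_
    have e4 := norm_add_le ⟪U (-t) Φ - Φ, A (U (-t) (B Φ))⟫_ℂ ⟪star B Φ, U t (A (U (-t) Φ - Φ))⟫_ℂ
    linarith
  have hGD : ∀ t : ℝ, G t - G (-t) =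
      -2 * Complex.I * ∑ k, c k * (Real.sin (ω k * t) : ℂ) := by
    intro t
    have q : ∀ r : ℝ, G r = ∑ k, (a k * Complex.exp (((ω k * -r : ℝ) : ℂ) * Complex.I)
        + b k * Complex.exp (((ω k * r : ℝ) : ℂ) * Complex.I)) := by
      intro r
      simp only [G, hUapp]
      rw [D.inner_phase_propagator _ hBΦ, D.inner_phase_propagator _ hAΦ,
        ← Finset.sum_add_distrib]
    rw [q, q, ← Finset.sum_sub_distrib, Finset.mul_sum]
    refine Finset.sum_congr rfl fun k _ => ?_
    rw [Complex.ofReal_sin, Complex.sin]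
    simp only [c]
    have e1 : ((ω k * - -t : ℝ) : ℂ) = ((ω k * t : ℝ) : ℂ) := by rw [neg_neg]
    have e2 : ((ω k * -t : ℝ) : ℂ) = -((ω k * t : ℝ) : ℂ) := by push_cast; ring
    rw [e1, e2]
    linear_combination (a k - b k) * (Complex.exp (-((ω k * t : ℝ) : ℂ) * Complex.I)
      - Complex.exp (((ω k * t : ℝ) : ℂ) * Complex.I)) * Complex.I_sq
  have hD1 : ∀ t : ℝ, 0 < t → ‖∑ k, c k * (Real.sin (ω k * t) : ℂ)‖ ≤
      N * (Real.exp (v * t) - 1) + 2 * δ * (‖A‖ * ‖B‖) * t := by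
    intro t ht
    have h1 := hG t
    have h2 := hG (-t)
    rw [abs_neg] at h2
    rw [abs_of_pos ht] at h1 h2
    have h3 := norm_sub_le (G t) (G (-t))
    rw [hGD, norm_mul, norm_mul, Complex.norm_I, norm_neg, mul_one, Complex.norm_ofNat] at h3
    linarith
  have hD2 : ∀ t : ℝ, ‖∑ k, c k * (Real.sin (ω k * t) : ℂ)‖ ≤ 2 * (‖A‖ * ‖B‖) := by
    intro t
    refine (norm_sum_le _ _).trans ((Finset.sum_le_sum fun k _ => ?_).trans hc)
    rw [norm_mul, Complex.norm_real]
    exact mul_le_of_le_one_right (norm_nonneg _) (Real.abs_sin_le_one _)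
  set α := ΔE / (2 * s) with hα
  have hα0 : 0 < α := by positivity
  have hfilter := norm_sum_mul_gaussSine_le c ω hα0 hs hN hD1 hD2
  -- the filter distinguishes the sector from the rest
  have hχ : ∀ k, |gaussSine α (ω k) - Real.pi / 2 * (if ev k ∈ S then 0 else 1)| ≤
      √(Real.pi / α) / 2 * δ + Real.pi / 2 * Real.exp (-(ΔE * s / 2)) := by
    intro k
    split_ifs with hk
    · rw [mul_zero, sub_zero]
      have h1 := abs_gaussSine_le hα0 (ω k)
      have h2 : √(Real.pi / α) / 2 * |ω k| ≤ √(Real.pi / α) / 2 * δ :=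
        mul_le_mul_of_nonneg_left (D.near k hk) (by positivity)
      have : 0 ≤ Real.pi / 2 * Real.exp (-(ΔE * s / 2)) := by positivity
      linarith
    · rw [mul_one]
      have hω : ΔE ≤ ω k := by
        have := D.gap k hk
        simp only [ω]
        linarith
      have h1 := abs_gaussSine_sub_le hα0 (hΔE.le.trans hω)
      have h2 : Real.exp (-(1 / (4 * α)) * ω k ^ 2) ≤ Real.exp (-(ΔE * s / 2)) := by
        have h3 : -(ΔE * s / 2) = -(1 / (4 * α)) * ΔE ^ 2 := by
          rw [hα]
          field_simp
          ring
        rw [h3]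
        refine Real.exp_le_exp.2 (mul_le_mul_of_nonpos_left
          (pow_le_pow_left₀ hΔE.le hω 2) ?_)
        have : 0 < 1 / (4 * α) := by positivity
        linarith
      have h4 := mul_le_mul_of_nonneg_left h2 (by positivity : 0 ≤ Real.pi / 2)
      have : 0 ≤ √(Real.pi / α) / 2 * δ := by positivity
      linarith
  have hsum : Real.pi / 2 * ∑ k, c k * (if ev k ∈ S then 0 else 1 : ℂ) =
      Real.pi * (⟪Φ, (A * B) Φ⟫_ℂ - 1 / 2 * (⟪Φ, A (P (B Φ))⟫_ℂ - ⟪Φ, B (P (A Φ))⟫_ℂ)) := by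
    have hinner : ∀ (ξ : E) {ψ : E}, ∑ k, ⟪e k, ψ⟫_ℂ • e k = ψ →
        ⟪ξ, ψ⟫_ℂ - ⟪ξ, P ψ⟫_ℂ = ∑ k, ⟪ξ, e k⟫_ℂ * ⟪e k, ψ⟫_ℂ * (if ev k ∈ S then 0 else 1 : ℂ) := by
      intro ξ ψ hψ
      have h2 : ⟪ξ, ψ⟫_ℂ = ∑ k, ⟪ξ, e k⟫_ℂ * ⟪e k, ψ⟫_ℂ := by
        conv_lhs => rw [← hψ, inner_sum]
        exact Finset.sum_congr rfl fun k _ => by rw [inner_smul_right, mul_comm]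
      rw [D.inner_proj ξ hψ, h2, ← Finset.sum_sub_distrib]
      refine Finset.sum_congr rfl fun k _ => ?_
      split_ifs <;> ring
    have h1 := hinner (star A Φ) hBΦ
    have h2 := hinner (star B Φ) hAΦ
    rw [hadj, hadj] at h1 h2
    have h3 : ∑ k, c k * (if ev k ∈ S then 0 else 1 : ℂ) =
        (⟪Φ, A (B Φ)⟫_ℂ - ⟪Φ, A (P (B Φ))⟫_ℂ) - (⟪Φ, B (A Φ)⟫_ℂ - ⟪Φ, B (P (A Φ))⟫_ℂ) := by
      rw [h1, h2, ← Finset.sum_sub_distrib]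
      refine Finset.sum_congr rfl fun k _ => ?_
      simp only [c, a, b]
      ring
    have h4 : ⟪Φ, A (B Φ)⟫_ℂ + ⟪Φ, B (A Φ)⟫_ℂ = 0 := by
      rw [← inner_add_right]
      have : A (B Φ) + B (A Φ) = (A * B + B * A) Φ := rfl
      rw [this, hAB, zero_apply, inner_zero_right]
    rw [h3, mul_apply_eq_comp]
    linear_combination (-(Real.pi : ℂ) / 2) * h4
  have hdiff : ‖Real.pi / 2 * ∑ k, c k * (if ev k ∈ S then 0 else 1 : ℂ)
      - ∑ k, c k * (gaussSine α (ω k) : ℂ)‖ ≤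
      (√(Real.pi / α) / 2 * δ + Real.pi / 2 * Real.exp (-(ΔE * s / 2))) * (2 * (‖A‖ * ‖B‖)) := by
    rw [Finset.mul_sum, ← Finset.sum_sub_distrib]
    refine (norm_sum_le _ _).trans ?_
    calc _ ≤ ∑ k, (√(Real.pi / α) / 2 * δ + Real.pi / 2 * Real.exp (-(ΔE * s / 2))) * ‖c k‖ := by
          refine Finset.sum_le_sum fun k _ => ?_
          have e1 : Real.pi / 2 * (c k * (if ev k ∈ S then 0 else 1 : ℂ))
              - c k * (gaussSine α (ω k) : ℂ) =
              -(((gaussSine α (ω k) - Real.pi / 2 * (if ev k ∈ S then 0 else 1) : ℝ) : ℂ) * c k) := by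
            split_ifs <;> push_cast <;> ring
          rw [e1, norm_neg, norm_mul, Complex.norm_real]
          exact mul_le_mul_of_nonneg_right (hχ k) (norm_nonneg _)
      _ ≤ _ := by
          rw [← Finset.mul_sum]
          exact mul_le_mul_of_nonneg_left hc (by positivity)
  have hfin : ‖Real.pi / 2 * ∑ k, c k * (if ev k ∈ S then 0 else 1 : ℂ)‖ ≤
      ‖∑ k, c k * (gaussSine α (ω k) : ℂ)‖ +
      (√(Real.pi / α) / 2 * δ + Real.pi / 2 * Real.exp (-(ΔE * s / 2))) * (2 * (‖A‖ * ‖B‖)) := by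
    refine (norm_le_norm_add_norm_sub' _ _).trans (add_le_add_right hdiff _)
  have hpi : ‖(Real.pi : ℂ)‖ = Real.pi := by
    rw [Complex.norm_real, Real.norm_of_nonneg Real.pi_pos.le]
  rw [hsum, norm_mul, hpi] at hfin
  have hexp : Real.exp (-α * s ^ 2) / (2 * α * s ^ 2) =
      Real.exp (-(ΔE * s / 2)) * (1 / (ΔE * s)) := by
    have h1 : -α * s ^ 2 = -(ΔE * s / 2) := by
      rw [hα]
      field_simp
    have h2 : 2 * α * s ^ 2 = ΔE * s := by
      rw [hα]
      field_simp
    rw [h1, h2]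
    ring
  rw [hexp] at hfilter
  refine (hfin.trans (add_le_add_left hfilter _)).trans (le_of_eq ?_)
  ring

end GappedBasis

end Spectral

theorem localAlgebra_mono {V M : Type*} [DecidableEq V] [LinearOrder M] (site : M → V) (d : V → ℕ)
    {X Y : Finset V} (h : X ⊆ Y) : localAlgebra site d X ≤ localAlgebra site d Y := by
  refine StarAlgebra.adjoin_mono ?_
  rintro T (⟨m, hm, rfl⟩ | ⟨x, hx, a, b, rfl⟩)
  · exact Or.inl ⟨m, h hm, rfl⟩
  · exact Or.inr ⟨x, h hx, a, b, rfl⟩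

/-- Observables with empty support are scalars. -/
theorem exists_smul_one_of_mem_localAlgebra_empty {V M : Type*} [DecidableEq V] [LinearOrder M]
    (site : M → V) (d : V → ℕ) {A : Op M d} (h : A ∈ localAlgebra site d ∅) :
    ∃ z : ℂ, A = z • 1 := by
  have hle : localAlgebra site d ∅ ≤ ⊥ := by
    refine StarAlgebra.adjoin_le ?_
    rintro T (⟨m, hm, rfl⟩ | ⟨x, hx, a, b, rfl⟩)
    · simp at hm
    · simp at hx
  obtain ⟨z, hz⟩ := StarSubalgebra.mem_bot.1 (hle h)
  exact ⟨z, by rw [← hz, Algebra.algebraMap_eq_smul_one]⟩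

namespace LatticeSystem

variable {V M : Type*} [DecidableEq V] [LinearOrder M] (L : LatticeSystem V M)

theorem hamiltonian_apply_mem_space (n : ℕ) {ψ : Hilb M L.d} (hψ : ψ ∈ L.space n) :
    L.hamiltonian n ψ ∈ L.space n := by
  rw [hamiltonian, sum_apply]
  exact Submodule.sum_mem _ fun X hX =>
    apply_mem_regionSpace L.site L.d (Finset.mem_powerset.1 hX) (L.h_mem n X) hψ

theorem sector_le_space (E₀ : ℕ → Finset ℝ) (n : ℕ) : L.sector E₀ n ≤ L.space n :=
  Submodule.span_le.2 fun _ hξ => hξ.1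

/-- Eigenvectors with an energy off the sector are orthogonal to the sector. -/
theorem inner_sector_eq_zero {E₀ : ℕ → Finset ℝ} {n : ℕ} {ψ : Hilb M L.d} {E : ℝ}
    (hψ : L.hamiltonian n ψ = (E : ℂ) • ψ) (hE : E ∉ E₀ n) {Φ : Hilb M L.d}
    (hΦ : Φ ∈ L.sector E₀ n) : ⟪ψ, Φ⟫_ℂ = 0 := by
  induction hΦ using Submodule.span_induction with
  | mem ξ hξ =>
    obtain ⟨_, e, he, hξe⟩ := hξ
    have h1 : ⟪L.hamiltonian n ψ, ξ⟫_ℂ = ⟪ψ, L.hamiltonian n ξ⟫_ℂ :=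
      (L.isSelfAdjoint_hamiltonian n).isSymmetric ψ ξ
    rw [hψ, hξe, inner_smul_left, inner_smul_right, Complex.conj_ofReal] at h1
    have h2 : (E : ℂ) ≠ e := by
      intro h
      exact hE (by rwa [Complex.ofReal_injective h])
    have h3 : ((E : ℂ) - e) * ⟪ψ, ξ⟫_ℂ = 0 := by linear_combination h1
    exact (mul_eq_zero.1 h3).resolve_left (sub_ne_zero.2 h2)
  | zero => exact inner_zero_right _
  | add x y _ _ hx hy => rw [inner_add_right, hx, hy, add_zero]
  | smul z x _ hx => rw [inner_smul_right, hx, mul_zero]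

theorem exists_gappedBasis {E₀ : ℕ → Finset ℝ} {ΔE : ℝ} (hgap : L.UniformGap E₀ ΔE) (n : ℕ) :
    ∃ (m : ℕ) (e : Fin m → Hilb M L.d) (ev : Fin m → ℝ) (e₀ : ℝ),
      GappedBasis (L.hamiltonian n) (L.sectorProj E₀ n) e ev (E₀ n) e₀
        (Metric.diam (E₀ n : Set ℝ)) ΔE ∧
      (∀ k, L.hamiltonian n (e k) = (ev k : ℂ) • e k) ∧
      ∀ ψ ∈ L.space n, ∑ k, ⟪e k, ψ⟫_ℂ • e k = ψ := by
  have := finiteDimensional_regionSpace L.site L.finite_modes L.d (L.Λ n)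
  obtain ⟨m, e, ev, he, hmem, heig, hspan⟩ := exists_eigenbasis (L.isSelfAdjoint_hamiltonian n)
    (L.space n) (fun ψ hψ => L.hamiltonian_apply_mem_space n hψ)
  obtain ⟨e₀, he₀⟩ := hgap.nonempty n
  refine ⟨m, e, ev, e₀, ⟨L.isSelfAdjoint_hamiltonian n, he, heig, ?_, ?_, ?_, ?_⟩, heig, hspan⟩
  · intro k hk
    exact Submodule.starProjection_eq_self_iff.2
      (Submodule.subset_span ⟨hmem k, ev k, hk, heig k⟩)
  · intro k hk
    refine (Submodule.starProjection_apply_eq_zero_iff _).2 ?_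
    rw [Submodule.mem_orthogonal']
    exact fun Φ hΦ => L.inner_sector_eq_zero (heig k) hk hΦ
  · intro k hk
    exact Metric.dist_le_diam_of_mem (E₀ n).finite_toSet.isBounded hk he₀
  · intro k hk
    exact hgap.gap n e₀ he₀ (ev k) ⟨e k, hmem k, he.ne_zero k, heig k⟩ hk

theorem setDist_eventually (X Y : Finset V) :
    ∀ᶠ n in atTop, setDist (L.bonds n) X Y = setDist L.graph X Y := by
  have h : ∀ᶠ n in atTop, ∀ x ∈ X, ∀ y ∈ Y, (L.bonds n).dist x y = L.graph.dist x y :=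
    X.eventually_all.2 fun x _ => Y.eventually_all.2 fun y _ => L.dist_eventually x y
  filter_upwards [h] with n hn
  unfold setDist
  congr 1
  ext r
  constructor
  · rintro ⟨x, hx, y, hy, rfl⟩
    exact ⟨x, hx, y, hy, hn x hx y hy⟩
  · rintro ⟨x, hx, y, hy, rfl⟩
    exact ⟨x, hx, y, hy, (hn x hx y hy).symm⟩

theorem subset_eventually (X : Finset V) : ∀ᶠ n in atTop, X ⊆ L.Λ n :=
  X.eventually_all.2 fun x _ => L.exhausts x

/-- The finite-volume version of `ω(AB) - [ω(A P₀ B) - ω(B P₀ A)] / 2`. -/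
noncomputable def sectorCorrelation (E₀ : ℕ → Finset ℝ) (n : ℕ) (Φ : Hilb M L.d)
    (A B : Op M L.d) : ℂ :=
  ⟪Φ, (A * B) Φ⟫_ℂ - 1 / 2 *
    (⟪Φ, A (L.sectorProj E₀ n (B Φ))⟫_ℂ - ⟪Φ, B (L.sectorProj E₀ n (A Φ))⟫_ℂ)

theorem norm_sectorCorrelation_le (E₀ : ℕ → Finset ℝ) (n : ℕ) {Φ : Hilb M L.d} (hΦ : ‖Φ‖ = 1)
    (A B : Op M L.d) : ‖L.sectorCorrelation E₀ n Φ A B‖ ≤ 2 * (‖A‖ * ‖B‖) := by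
  have hP : ‖L.sectorProj E₀ n‖ ≤ 1 := Submodule.starProjection_norm_le _
  have hexpect : ∀ T : Op M L.d, ‖⟪Φ, T Φ⟫_ℂ‖ ≤ ‖T‖ := by
    intro T
    refine (norm_inner_le_norm _ _).trans ?_
    have := T.le_opNorm Φ
    rw [hΦ, mul_one] at this
    rwa [hΦ, one_mul]
  have hthree : ∀ T T' : Op M L.d, ‖T * L.sectorProj E₀ n * T'‖ ≤ ‖T‖ * ‖T'‖ := by
    intro T T'
    calc _ ≤ ‖T‖ * ‖L.sectorProj E₀ n‖ * ‖T'‖ :=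
          (norm_mul_le _ _).trans (mul_le_mul_of_nonneg_right (norm_mul_le _ _) (norm_nonneg _))
      _ ≤ ‖T‖ * 1 * ‖T'‖ := by gcongr
      _ = _ := by rw [mul_one]
  have h1 := (hexpect (A * B)).trans (norm_mul_le _ _)
  have h2 := (hexpect (A * L.sectorProj E₀ n * B)).trans (hthree _ _)
  have h3 := (hexpect (B * L.sectorProj E₀ n * A)).trans (hthree _ _)
  have h4 : ‖L.sectorCorrelation E₀ n Φ A B‖ ≤ ‖⟪Φ, (A * B) Φ⟫_ℂ‖ + 1 / 2 *
      (‖⟪Φ, (A * L.sectorProj E₀ n * B) Φ⟫_ℂ‖ + ‖⟪Φ, (B * L.sectorProj E₀ n * A) Φ⟫_ℂ‖) := by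
    refine (norm_sub_le _ _).trans (add_le_add_right ?_ _)
    rw [norm_mul]
    refine mul_le_mul (by norm_num) (norm_sub_le _ _) (norm_nonneg _) (by norm_num)
  linarith [mul_comm ‖A‖ ‖B‖]

theorem IsGroundStateLimit.tendsto_sectorCorrelation {L : LatticeSystem V M} {E₀ : ℕ → Finset ℝ}
    {φ : ℕ → ℕ} {Φ : ℕ → Hilb M L.d} {ω : Op M L.d → ℂ} {ωP : Op M L.d → Op M L.d → ℂ}
    (hω : L.IsGroundStateLimit E₀ φ Φ ω ωP) {X Y : Finset V} {A B : Op M L.d}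
    (hA : A ∈ L.obs X) (hB : B ∈ L.obs Y) :
    Tendsto (fun j => L.sectorCorrelation E₀ (φ j) (Φ (φ j)) A B) atTop
      (𝓝 (ω (A * B) - 1 / 2 * (ωP A B - ωP B A))) := by
  have hAB : A * B ∈ L.obs (X ∪ Y) :=
    mul_mem (localAlgebra_mono _ _ Finset.subset_union_left hA)
      (localAlgebra_mono _ _ Finset.subset_union_right hB)
  exact (hω.tendsto _ _ hAB).sub
    (((hω.tendsto_proj X Y A hA B hB).sub (hω.tendsto_proj Y X B hB A hA)).const_mul _)

/-- A fermionic pair with an empty support is trivial. -/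
theorem FermionicPair.norm_mul_norm_eq_zero {L : LatticeSystem V M} {X Y : Finset V}
    {A B : Op M L.d} (h : L.FermionicPair X Y A B) (hXY : X.card = 0 ∨ Y.card = 0) :
    ‖A‖ * ‖B‖ = 0 := by
  obtain ⟨hA, hB, hanti⟩ := h
  have hscalar : ∀ (z : ℂ) (T : Op M L.d), z • T + z • T = 0 → z = 0 ∨ T = 0 := by
    intro z T h
    rwa [← two_smul ℂ, smul_eq_zero, or_iff_right two_ne_zero, smul_eq_zero] at h
  rcases hXY with h | h
  · rw [Finset.card_eq_zero] at h
    subst h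
    obtain ⟨z, rfl⟩ := exists_smul_one_of_mem_localAlgebra_empty _ _ hA
    have h1 := hanti (Finset.disjoint_empty_left _)
    rw [smul_mul_assoc, mul_smul_comm, one_mul, mul_one] at h1
    rcases hscalar z B h1 with h2 | h2
    · rw [h2, zero_smul, norm_zero, zero_mul]
    · rw [h2, norm_zero, mul_zero]
  · rw [Finset.card_eq_zero] at h
    subst h
    obtain ⟨z, rfl⟩ := exists_smul_one_of_mem_localAlgebra_empty _ _ hB
    have h1 := hanti (Finset.disjoint_empty_right _)
    rw [smul_mul_assoc, mul_smul_comm, one_mul, mul_one] at h1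
    rcases hscalar z A h1 with h2 | h2
    · rw [h2, zero_smul, norm_zero, mul_zero]
    · rw [h2, norm_zero, zero_mul]

/-- The estimate in the infinite volume, for supports at a positive distance. -/
theorem IsGroundStateLimit.norm_le_of_anticommutator_bound {L : LatticeSystem V M}
    {E₀ : ℕ → Finset ℝ} {φ : ℕ → ℕ} {Φ : ℕ → Hilb M L.d} {ω : Op M L.d → ℂ}
    {ωP : Op M L.d → Op M L.d → ℂ} (hω : L.IsGroundStateLimit E₀ φ Φ ω ωP) {ΔE : ℝ}
    (hgap : L.UniformGap E₀ ΔE) {X Y : Finset V} {A B : Op M L.d}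
    (hpair : L.FermionicPair X Y A B) (hdisj : Disjoint X Y) {N v s : ℝ} (hN : 0 ≤ N)
    (hs : 0 < s)
    (hLR : ∀ᶠ n in atTop, ∀ t, ‖L.evolve n t A * B + B * L.evolve n t A‖ ≤
      N * (Real.exp (v * |t|) - 1)) :
    Real.pi * ‖ω (A * B) - 1 / 2 * (ωP A B - ωP B A)‖ ≤ N * Real.exp (v * s) +
      ‖A‖ * ‖B‖ * ((2 / (ΔE * s) + Real.pi) * Real.exp (-(ΔE * s / 2))) := by
  obtain ⟨hA, hB, hanti⟩ := hpair
  set K := ‖A‖ * ‖B‖ * (2 * s + √(Real.pi / (ΔE / (2 * s)))) with hK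
  set b := N * Real.exp (v * s) +
    ‖A‖ * ‖B‖ * ((2 / (ΔE * s) + Real.pi) * Real.exp (-(ΔE * s / 2))) with hb
  have hφ := hω.strictMono.tendsto_atTop
  have hev : ∀ᶠ j in atTop, Real.pi * ‖L.sectorCorrelation E₀ (φ j) (Φ (φ j)) A B‖ ≤
      b + K * Metric.diam (E₀ (φ j) : Set ℝ) := by
    filter_upwards [hφ.eventually hLR, hφ.eventually (L.subset_eventually X),
      hφ.eventually (L.subset_eventually Y)] with j hj hXΛ hYΛ
    obtain ⟨m, e, ev, e₀, D, heig, hspan⟩ := L.exists_gappedBasis hgap (φ j)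
    have hΦ := L.sector_le_space E₀ (φ j) (hω.mem_sector (φ j))
    refine D.norm_correlation_le
      (hspan _ (apply_mem_regionSpace _ _ hXΛ hA hΦ))
      (hspan _ (apply_mem_regionSpace _ _ hYΛ hB hΦ)) (hspan _ hΦ)
      (fun k hk => L.inner_sector_eq_zero (heig k) hk (hω.mem_sector (φ j)))
      (hω.norm_eq_one _) Metric.diam_nonneg hgap.gap_pos (hanti hdisj) hN hs fun t => ?_
    rw [← evolve_eq_heisenberg]
    exact hj t
  have hdiam : Tendsto (fun j => b + K * Metric.diam (E₀ (φ j) : Set ℝ)) atTop (𝓝 b) := by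
    have h := ((hgap.spread.comp hφ).const_mul K).const_add b
    rw [mul_zero, add_zero] at h
    exact h
  exact le_of_tendsto_of_tendsto
    ((hω.tendsto_sectorCorrelation hA hB).norm.const_mul Real.pi) hdiam hev

/-- A group velocity bound and a uniform gap imply clustering. -/
theorem fermionicClustering_of_groupVelocityBound {ℓ : ℕ → ℝ} (hℓ0 : ℓ 0 = 0) {v : ℝ} (hv : 0 < v)
    (hGV : L.GroupVelocityBound (fun r => Real.exp (-ℓ r)) v) {ΔE : ℝ} (hΔE : 0 < ΔE) :
    L.FermionicClustering ΔE (fun r => Real.exp (-(ℓ r / (1 + 2 * v / ΔE)))) := by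
  obtain ⟨C, hC, hGV⟩ := hGV
  refine ⟨2 * Real.exp (ΔE / 2) + (C + 2 / ΔE + Real.pi), ?_⟩
  intro E₀ hgap φ Φ ω ωP hω X Y A B hpair
  set Z := ω (A * B) - 1 / 2 * (ωP A B - ωP B A) with hZ
  have htriv : ‖Z‖ ≤ 2 * (‖A‖ * ‖B‖) :=
    le_of_tendsto' (hω.tendsto_sectorCorrelation hpair.1 hpair.2.1).norm fun j =>
      L.norm_sectorCorrelation_le E₀ (φ j) (hω.norm_eq_one _) A B
  by_cases hcard : X.card = 0 ∨ Y.card = 0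
  · rw [hpair.norm_mul_norm_eq_zero hcard, mul_zero] at htriv
    have hC' : 0 ≤ 2 * Real.exp (ΔE / 2) + (C + 2 / ΔE + Real.pi) := by positivity
    exact htriv.trans (mul_nonneg (mul_nonneg (mul_nonneg (mul_nonneg (mul_nonneg hC'
      (norm_nonneg _)) (norm_nonneg _)) (Nat.cast_nonneg _)) (Nat.cast_nonneg _))
      (Real.exp_pos _).le)
  have hXY : (1 : ℝ) ≤ (X.card : ℝ) * Y.card := by
    rw [not_or] at hcard
    have h1 := Nat.pos_of_ne_zero hcard.1
    have h2 := Nat.pos_of_ne_zero hcard.2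
    exact_mod_cast Nat.mul_pos h1 h2
  set r := setDist L.graph X Y with hr
  set s := ℓ r / (v + ΔE / 2) with hs
  have hrate : ℓ r / (1 + 2 * v / ΔE) = ΔE * s / 2 := by
    rw [hs]
    field_simp
    ring
  simp only [hrate]
  set g := Real.exp (-(ΔE * s / 2)) with hg
  have hg0 : 0 < g := Real.exp_pos _
  have hAB0 : 0 ≤ ‖A‖ * ‖B‖ := by positivity
  rcases lt_or_ge s 1 with hs1 | hs1
  · have h1 : 1 ≤ Real.exp (ΔE / 2) * g := by
      rw [hg, ← Real.exp_add]
      refine Real.one_le_exp ?_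
      nlinarith
    calc ‖Z‖ ≤ 2 * (‖A‖ * ‖B‖) * 1 * 1 := by linarith
      _ ≤ 2 * (‖A‖ * ‖B‖) * (Real.exp (ΔE / 2) * g) * ((X.card : ℝ) * Y.card) := by gcongr
      _ = (2 * Real.exp (ΔE / 2)) * (‖A‖ * ‖B‖ * (X.card * Y.card) * g) := by ring
      _ ≤ (2 * Real.exp (ΔE / 2) + (C + 2 / ΔE + Real.pi)) *
          (‖A‖ * ‖B‖ * (X.card * Y.card) * g) := by
        gcongr
        have : 0 < C + 2 / ΔE + Real.pi := by positivity
        linarith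
      _ = _ := by ring
  · have hs0 : 0 < s := zero_lt_one.trans_le hs1
    have hrpos : 0 < r := by
      refine Nat.pos_of_ne_zero fun h0 => ?_
      rw [hs, h0, hℓ0, zero_div] at hs0
      exact lt_irrefl _ hs0
    set N := C * ‖A‖ * ‖B‖ * X.card * Y.card * Real.exp (-ℓ r) with hN
    have hN0 : 0 ≤ N := by positivity
    have hNs : N * Real.exp (v * s) = C * (‖A‖ * ‖B‖ * (X.card * Y.card) * g) := by
      have : Real.exp (-ℓ r) * Real.exp (v * s) = g := by
        rw [← Real.exp_add, hg]
        congr 1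
        rw [hs]
        field_simp
        ring
      rw [hN, ← this]
      ring
    have hlim : Real.pi * ‖Z‖ ≤ N * Real.exp (v * s) +
        ‖A‖ * ‖B‖ * ((2 / (ΔE * s) + Real.pi) * g) := by
      refine hω.norm_le_of_anticommutator_bound hgap hpair ?_ hN0 hs0 ?_
      · obtain ⟨n, hn⟩ := (L.setDist_eventually X Y).exists
        exact disjoint_of_setDist_pos (L.bonds n) (by rwa [hn])
      · filter_upwards [L.setDist_eventually X Y, L.subset_eventually X, L.subset_eventually Y]
          with n hdist hXΛ hYΛ t
        have h := (hGV n X Y A B t hXΛ hYΛ (by rwa [hdist])).2 hpair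
        rwa [hdist] at h
    have hpi : ‖Z‖ ≤ Real.pi * ‖Z‖ :=
      le_mul_of_one_le_left (norm_nonneg _) (by linarith [Real.pi_gt_three])
    have hdiv : 2 / (ΔE * s) ≤ 2 / ΔE := by
      gcongr
      exact le_mul_of_one_le_right hΔE.le hs1
    calc ‖Z‖ ≤ N * Real.exp (v * s) + ‖A‖ * ‖B‖ * ((2 / (ΔE * s) + Real.pi) * g) :=
          hpi.trans hlim
      _ ≤ C * (‖A‖ * ‖B‖ * (X.card * Y.card) * g) +
          ‖A‖ * ‖B‖ * ((2 / ΔE + Real.pi) * g) * (X.card * Y.card) := by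
        rw [hNs]
        refine add_le_add_right ?_ _
        calc _ ≤ ‖A‖ * ‖B‖ * ((2 / ΔE + Real.pi) * g) * 1 := by
              rw [mul_one]
              gcongr
          _ ≤ _ := by gcongr
      _ = (C + 2 / ΔE + Real.pi) * (‖A‖ * ‖B‖ * (X.card * Y.card) * g) := by ring
      _ ≤ (2 * Real.exp (ΔE / 2) + (C + 2 / ΔE + Real.pi)) *
          (‖A‖ * ‖B‖ * (X.card * Y.card) * g) := by
        refine mul_le_mul_of_nonneg_right ?_ (by positivity)
        have := Real.exp_pos (ΔE / 2)
        linarith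
      _ = _ := by ring

theorem GroupVelocityBound.mono {L : LatticeSystem V M} {g g' : ℕ → ℝ} {v v' : ℝ}
    (h : L.GroupVelocityBound g v) (hg' : ∀ r, 0 ≤ g' r) (hg : ∀ r, g r ≤ g' r)
    (hv : 0 ≤ v) (hvv : v ≤ v') : L.GroupVelocityBound g' v' := by
  obtain ⟨C, hC, h⟩ := h
  refine ⟨C, hC, fun n X Y A B t hX hY hd => ?_⟩
  have hexp : 0 ≤ Real.exp (v * |t|) - 1 := sub_nonneg.2 (Real.one_le_exp (by positivity))
  have hle : C * ‖A‖ * ‖B‖ * X.card * Y.card * g (setDist (L.bonds n) X Y) *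
      (Real.exp (v * |t|) - 1) ≤ C * ‖A‖ * ‖B‖ * X.card * Y.card *
        g' (setDist (L.bonds n) X Y) * (Real.exp (v' * |t|) - 1) := by
    have h1 := hg (setDist (L.bonds n) X Y)
    have h2 := hg' (setDist (L.bonds n) X Y)
    gcongr
  exact ⟨fun hp => ((h n X Y A B t hX hY hd).1 hp).trans hle,
    fun hp => ((h n X Y A B t hX hY hd).2 hp).trans hle⟩

end LatticeSystem

/-- If a bound at a larger exponent implies the bound at a smaller one, then the velocities can be
chosen strictly increasing in the exponent. -/
theorem exists_strictMonoOn_velocity {S : Set ℝ} {Q : ℝ → ℝ → Prop} (hpos : ∀ η ∈ S, 0 < η)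
    (hex : ∀ η ∈ S, ∃ v, 0 < v ∧ Q η v)
    (hmono : ∀ {η η' v v'}, η ∈ S → η ≤ η' → 0 < v → v ≤ v' → Q η' v → Q η v') :
    ∃ f : ℝ → ℝ, StrictMonoOn f S ∧ ∀ η ∈ S, 0 < f η ∧ Q η (f η) := by
  let T : ℝ → Set ℝ := fun η => {w | 0 < w ∧ ∃ η' ∈ S, η ≤ η' ∧ Q η' w}
  have hne : ∀ η ∈ S, (T η).Nonempty := fun η hη => by
    obtain ⟨v, hv, hQ⟩ := hex η hη
    exact ⟨v, hv, η, hη, le_rfl, hQ⟩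
  have hbdd : ∀ η, BddBelow (T η) := fun η => ⟨0, fun w hw => hw.1.le⟩
  have hinf : ∀ η, 0 ≤ sInf (T η) := fun η => Real.sInf_nonneg fun w hw => hw.1.le
  refine ⟨fun η => sInf (T η) + η, ?_, ?_⟩
  · intro η hη η' hη' hlt
    have hsub : T η' ⊆ T η := by
      rintro w ⟨hw, η₁, h1, h2, h3⟩
      exact ⟨hw, η₁, h1, hlt.le.trans h2, h3⟩
    have := csInf_le_csInf (hbdd η) (hne η' hη') hsub
    exact add_lt_add_of_le_of_lt this hlt
  · intro η hη
    refine ⟨add_pos_of_nonneg_of_pos (hinf η) (hpos η hη), ?_⟩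
    obtain ⟨w, ⟨hw, η', hη', hle, hQ⟩, hlt⟩ := exists_lt_of_csInf_lt (hne η hη)
      (lt_add_of_pos_right (sInf (T η)) (hpos η hη))
    exact hmono hη hle hw hlt.le hQ

end LatticeFermion

theorem mainTheorem3 {V M : Type*} [DecidableEq V] [Infinite V] [LinearOrder M]
    (L : LatticeFermion.LatticeSystem V M) :
    (∃ v : ℝ → ℝ, StrictMonoOn v {η | L.PowerLaw η} ∧
      ∀ η : ℝ, L.PowerLaw η →
        0 < v η ∧
        L.GroupVelocityBound (fun r => (1 + (r : ℝ)) ^ (-η)) (v η) ∧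
        ∀ ΔE : ℝ, 0 < ΔE →
          L.FermionicClustering ΔE
            (fun r => (1 + (r : ℝ)) ^ (-(η / (1 + 2 * v η / ΔE))))) ∧
    (∃ v : ℝ → ℝ, StrictMonoOn v {μ | L.Exponential μ} ∧
      ∀ μ : ℝ, L.Exponential μ →
        0 < v μ ∧
        L.GroupVelocityBound (fun r => Real.exp (-(μ * (r : ℝ)))) (v μ) ∧
        ∀ ΔE : ℝ, 0 < ΔE →
          L.FermionicClustering ΔE
            (fun r => Real.exp (-(μ / (1 + 2 * v μ / ΔE) * (r : ℝ))))) := by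
  constructor
  · obtain ⟨v, hmono, hv⟩ := LatticeFermion.exists_strictMonoOn_velocity
      (S := {η | L.PowerLaw η})
      (Q := fun η w => L.GroupVelocityBound (fun r => (1 + (r : ℝ)) ^ (-η)) w)
      (fun η hη => hη.1) (fun η hη => L.exists_groupVelocityBound_power hη)
      (fun {η η' w w'} hη hle hw hww h => h.mono (fun r => by positivity)
        (fun r => Real.rpow_le_rpow_of_exponent_le (by simp) (by linarith)) hw.le hww)
    refine ⟨v, hmono, fun η hη => ⟨(hv η hη).1, (hv η hη).2, fun ΔE hΔE => ?_⟩⟩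
    have hpow : ∀ (r : ℕ) (a : ℝ), (1 + (r : ℝ)) ^ a = Real.exp (Real.log (1 + (r : ℝ)) * a) :=
      fun r a => Real.rpow_def_of_pos (by positivity) a
    have h := L.fermionicClustering_of_groupVelocityBound
      (ℓ := fun r => Real.log (1 + (r : ℝ)) * η) (by simp) (hv η hη).1
      (by simpa only [hpow, mul_neg] using (hv η hη).2) hΔE
    simpa only [hpow, mul_neg, mul_div_assoc] using h
  · obtain ⟨v, hmono, hv⟩ := LatticeFermion.exists_strictMonoOn_velocity
      (S := {μ | L.Exponential μ})
      (Q := fun μ w => L.GroupVelocityBound (fun r => Real.exp (-(μ * (r : ℝ)))) w)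
      (fun μ hμ => hμ.1) (fun μ hμ => L.exists_groupVelocityBound_exp hμ)
      (fun {μ μ' w w'} hμ hle hw hww h => h.mono (fun r => (Real.exp_pos _).le)
        (fun r => by gcongr) hw.le hww)
    refine ⟨v, hmono, fun μ hμ => ⟨(hv μ hμ).1, (hv μ hμ).2, fun ΔE hΔE => ?_⟩⟩
    have h := L.fermionicClustering_of_groupVelocityBound
      (ℓ := fun r => μ * (r : ℝ)) (by simp) (hv μ hμ).1 (hv μ hμ).2 hΔE
    simpa only [div_mul_eq_mul_div] using h
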